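/- Let $q$ and $a$ be complex numbers with $|q|<1$. For $x\in\mathbb C$ and an integer $n\ge 0$ write $(x)_n=\prod_{0\le i<n}(1-xq^i)$, $(x)_\infty=\prod_{i\ge0}(1-xq^i)$ and $(x_1,\dots,x_m)_n=(x_1)_n\cdots(x_m)_n$. Let $0<r\le k$ be integers, and let $b_1,\dots,b_{2r-1}$ be nonzero complex numbers such that $aq^n\ne1$ and $aq^n\ne b_i$ for all $n\ge0$ and $1\le i\le 2r-1$. (i) If $r<k$, and $c_1,c_2$ are nonzero complex numbers with $aq^{n+1}\ne c_1$ and $aq^{n+1}\ne c_2$ for all $n\ge0$, then $$\sum_{s_1\ge\dots\ge s_{k-1}\ge0}(-1)^{s_1}\frac{a^{s_1+\dots+s_{k-1}}q^{s_1^2/2+s_{r+1}^2+\dots+s_{k-1}^2-s_1/2+s_r}}{b_1^{s_1}(b_2b_{2r-1})^{s_2}\cdots(b_rb_{r+1})^{s_r}}\,\frac{(aq/c_1c_2)_{s_{k-1}}}{(q,aq/c_1,aq/c_2)_{s_{k-1}}}$$ $$\times\frac{(b_1)_{s_1}(b_2,b_{2r-1})_{s_2}\cdots(b_r,b_{r+1})_{s_r}}{(q)_{s_1-s_2}\cdots(q)_{s_{k-2}-s_{k-1}}}\,\frac{(a/b_2b_{2r-1})_{s_1-s_2}\cdots(a/b_rb_{r+1})_{s_{r-1}-s_r}}{(a/b_2,a/b_{2r-1})_{s_1}\cdots(a/b_r,a/b_{r+1})_{s_{r-1}}}$$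 $$=\frac{(a/b_1)_\infty}{(a)_\infty}\sum_{j\ge0}\frac{(b_1,\dots,b_{2r-1},c_1,c_2,a)_j\,(b_1\cdots b_{2r-1}c_1c_2)^{-j}a^{kj}q^{(k-r)j^2+j}}{(a/b_1,\dots,a/b_{2r-1},aq/c_1,aq/c_2,q)_j}\left(1+\frac{a^rq^j}{b_1\cdots b_{2r-1}}\prod_{i=1}^{2r-1}\frac{1-b_iq^j}{1-aq^j/b_i}\right),$$ both series being absolutely convergent. (ii) If $r\le k$ (in particular if $r=k$, where one reads $s_k=0$, and for $r=k=1$ the left-hand side is the single term $1$), the same identity holds in the limit $c_1,c_2\to\infty$. That is, for all $c_1,c_2$ of sufficiently large modulus both series above converge absolutely; as $c_1,c_2\to\infty$ (jointly) the two sides above tend to the absolutely convergent expressions obtained by taking the limit in each summand, i.e. on the left by replacing $\frac{(aq/c_1c_2)_{s_{k-1}}}{(q,aq/c_1,aq/c_2)_{s_{k-1}}}$ with $\frac1{(q)_{s_{k-1}}}$, and on the right by replacing $\frac{(c_1,c_2)_j(c_1c_2)^{-j}}{(aq/c_1,aq/c_2)_j}$ with $q^{j(j-1)}$; and these two limits are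 equal. -/

import Mathlib

noncomputable section

namespace BressoudIdentity

/-- The finite `q`-shifted factorial `(x; q)_n = ∏_{0 ≤ i < n} (1 - x q^i)`, for `n ≥ 0`. -/
def qPoch (q x : ℂ) (n : ℕ) : ℂ := ∏ i ∈ Finset.range n, (1 - x * q ^ i)

/-- The infinite `q`-shifted factorial `(x; q)_∞ = ∏_{i ≥ 0} (1 - x q^i)`; the product converges
when `‖q‖ < 1`. -/
def qPochInf (q x : ℂ) : ℂ := ∏' i : ℕ, (1 - x * q ^ i)

/-- The set of chains `s_1 ≥ s_2 ≥ ⋯ ≥ s_m ≥ 0` of natural numbers. -/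
def Chain (m : ℕ) : Type := {s : Fin m → ℕ // Antitone s}

/-- The entry `s_i` of a chain, with the 1-based index `1 ≤ i ≤ m`, and `s_i = 0` for any other
index. -/
def Chain.entry {m : ℕ} (s : Chain m) (i : ℕ) : ℕ :=
  if h : 1 ≤ i ∧ i ≤ m then s.1 ⟨i - 1, by omega⟩ else 0

/-- The part of the summand of the multisum that does not involve `c_1, c_2`. The parameters are
`b 1, …, b (2r-1)`, and `b i` is paired with `b (2r+1-i)` for `2 ≤ i ≤ r`. The exponent
`s_1^2/2 - s_1/2` is the binomial coefficient `s_1.choose 2`. For `r = k` the entry `s_r` is `0`. -/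
def lhsCore (q a : ℂ) (b : ℕ → ℂ) (k r : ℕ) (s : Chain (k - 1)) : ℂ :=
  (-1) ^ s.entry 1
    * (a ^ (∑ i ∈ Finset.Icc 1 (k - 1), s.entry i)
        * q ^ ((s.entry 1).choose 2 + (∑ i ∈ Finset.Icc (r + 1) (k - 1), s.entry i ^ 2)
            + s.entry r)
        / (b 1 ^ s.entry 1 * ∏ i ∈ Finset.Icc 2 r, (b i * b (2 * r + 1 - i)) ^ s.entry i))
    * (1 / qPoch q q (s.entry (k - 1)))
    * (qPoch q (b 1) (s.entry 1)
          * ∏ i ∈ Finset.Icc 2 r,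
              (qPoch q (b i) (s.entry i) * qPoch q (b (2 * r + 1 - i)) (s.entry i)))
    / (∏ i ∈ Finset.Icc 1 (k - 2), qPoch q q (s.entry i - s.entry (i + 1)))
    * ((∏ i ∈ Finset.Icc 2 r,
            qPoch q (a / (b i * b (2 * r + 1 - i))) (s.entry (i - 1) - s.entry i))
        / ∏ i ∈ Finset.Icc 2 r,
            (qPoch q (a / b i) (s.entry (i - 1))
              * qPoch q (a / b (2 * r + 1 - i)) (s.entry (i - 1))))

/-- The summand of the multisum: the core times
`(aq/c_1c_2)_{s_{k-1}} / (aq/c_1, aq/c_2)_{s_{k-1}}`. -/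
def lhsTerm (q a c₁ c₂ : ℂ) (b : ℕ → ℂ) (k r : ℕ) (s : Chain (k - 1)) : ℂ :=
  lhsCore q a b k r s
    * (qPoch q (a * q / (c₁ * c₂)) (s.entry (k - 1))
        / (qPoch q (a * q / c₁) (s.entry (k - 1)) * qPoch q (a * q / c₂) (s.entry (k - 1))))

/-- The part of the `j`-th summand of the single sum that involves neither `c_1, c_2` nor the
power of `q` in front. -/
def rhsCore (q a : ℂ) (b : ℕ → ℂ) (k r j : ℕ) : ℂ :=
  (∏ i ∈ Finset.Icc 1 (2 * r - 1), qPoch q (b i) j) * qPoch q a j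
    * ((∏ i ∈ Finset.Icc 1 (2 * r - 1), b i) ^ j)⁻¹ * a ^ (k * j)
    / ((∏ i ∈ Finset.Icc 1 (2 * r - 1), qPoch q (a / b i) j) * qPoch q q j)
    * (1 + a ^ r * q ^ j / (∏ i ∈ Finset.Icc 1 (2 * r - 1), b i)
        * ((∏ i ∈ Finset.Icc 1 (2 * r - 1), (1 - b i * q ^ j))
          / ∏ i ∈ Finset.Icc 1 (2 * r - 1), (1 - a * q ^ j / b i)))

/-- The `j`-th summand of the single sum. -/
def rhsTerm (q a c₁ c₂ : ℂ) (b : ℕ → ℂ) (k r j : ℕ) : ℂ :=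
  rhsCore q a b k r j * q ^ ((k - r) * j ^ 2 + j)
    * (qPoch q c₁ j * qPoch q c₂ j * ((c₁ * c₂) ^ j)⁻¹
        / (qPoch q (a * q / c₁) j * qPoch q (a * q / c₂) j))

/-- The limit of the `j`-th summand of the single sum as `c_1, c_2 → ∞`: each `(c)_j c^{-j}` tends
to `(-1)^j q^{j(j-1)/2}`, and each `(aq/c)_j` to `1`. -/
def rhsTermLim (q a : ℂ) (b : ℕ → ℂ) (k r j : ℕ) : ℂ :=
  rhsCore q a b k r j * q ^ ((k - r) * j ^ 2 + j + j * (j - 1))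

/-- The left-hand side: the sum over all chains `s_1 ≥ ⋯ ≥ s_{k-1} ≥ 0`. -/
def lhs (q a c₁ c₂ : ℂ) (b : ℕ → ℂ) (k r : ℕ) : ℂ :=
  ∑' s : Chain (k - 1), lhsTerm q a c₁ c₂ b k r s

/-- The right-hand side: `(a/b_1)_∞ / (a)_∞` times the single sum. -/
def rhs (q a c₁ c₂ : ℂ) (b : ℕ → ℂ) (k r : ℕ) : ℂ :=
  qPochInf q (a / b 1) / qPochInf q a * ∑' j : ℕ, rhsTerm q a c₁ c₂ b k r j

end BressoudIdentity

end

noncomputable section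

namespace BressoudIdentity

open Finset Filter Topology

/-! The identity comes from walking along a Bailey chain. The start is the unit Bailey pair relative
to `a`, whose `β` is `δ_{n,0}`. Each use of the Bailey lemma adds one summation to `β` and one
explicit factor to `α`, so `k - 1` uses produce a sum over chains.

The innermost `k - r` uses are relative to `a`: the first has parameters `c₁, c₂` (or both
infinite), the others have both parameters infinite. The pair is then turned into one relative to `a
/ q` (`IsBailey.change`). This multiplies `β_n` by `q^n`, the source of `q^{s_r}`, and makes `α` a
difference `G_j - G_{j-1}`. Next come `r - 1` uses with the parameter pairs `b_i, b_{2r+1-i}`. A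
last use with parameters `b_1, ∞` and `n → ∞` (`IsBailey.tsum_eq`) sums over the outermost index
`s_1` and yields `(a/b_1)_∞ / (a)_∞`. The `β` side is the multisum. The `α` side is `∑ F_j (G_j -
G_{j-1})`, which summation by parts turns into `∑ (F_j - F_{j+1}) G_j`; the step from `F_j` to
`F_{j+1}` contributes minus the second term of the bracket.

Parameters enter only through their inverses, in `br`, so an infinite parameter is the value `0` and
needs no limit. Thus the identity at `c₁ = c₂ = ∞`, including `r = k`, is another instance of
`tsum_chain_eq`. All series converge because `br q 1 0 n = (-1)^n q^{n(n-1)/2}` decays faster than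
any exponential, whereas the remaining factors grow at most exponentially. The limits `c₁, c₂ → ∞`
are dominated convergence on each side. -/

/-- The shifted product `∏_{i < n} (s - p q^i)`; for `s = 1/ρ` and `p = 1` it equals `(ρ)_n ρ^{-n}`,
and for `s = 0` it is the limit of that as `ρ → ∞`. -/
def br (q p s : ℂ) (n : ℕ) : ℂ := ∏ i ∈ range n, (s - p * q ^ i)

/-- The kernel of the Bailey lemma, with `s = 1/ρ₁` and `t = 1/ρ₂`, relative to `x / q`. -/
def kern (q x s t : ℂ) (n j : ℕ) : ℂ :=
  br q 1 s j * br q 1 t j * x ^ j * qPoch q (x * s * t) (n - j)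
    / (qPoch q q (n - j) * qPoch q (x * s) n * qPoch q (x * t) n)

/-- The factor by which the Bailey lemma multiplies `α_j`. -/
def mult (q x s t : ℂ) (j : ℕ) : ℂ :=
  br q 1 s j * br q 1 t j * x ^ j / (qPoch q (x * s) j * qPoch q (x * t) j)

/-- `(α, β)` is a Bailey pair relative to `x / q`. -/
def IsBailey (q x : ℂ) (α β : ℕ → ℂ) : Prop :=
  ∀ n, β n = ∑ j ∈ range (n + 1), α j / (qPoch q q (n - j) * qPoch q x (n + j))

theorem qPoch_zero (q x : ℂ) : qPoch q x 0 = 1 := by simp [qPoch]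

theorem qPoch_succ (q x : ℂ) (n : ℕ) : qPoch q x (n + 1) = qPoch q x n * (1 - x * q ^ n) := by
  simp [qPoch, prod_range_succ]

theorem qPoch_succ' (q x : ℂ) (n : ℕ) : qPoch q x (n + 1) = (1 - x) * qPoch q (x * q) n := by
  rw [qPoch, prod_range_succ', mul_comm]
  simp [qPoch, pow_succ', mul_assoc]

theorem qPoch_add (q x : ℂ) (m n : ℕ) :
    qPoch q x (m + n) = qPoch q x m * qPoch q (x * q ^ m) n := by
  simp [qPoch, prod_range_add, pow_add, mul_assoc]

theorem br_zero (q p s : ℂ) : br q p s 0 = 1 := by simp [br]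

theorem br_succ (q p s : ℂ) (n : ℕ) : br q p s (n + 1) = br q p s n * (s - p * q ^ n) := by
  simp [br, prod_range_succ]

theorem br_add (q p s : ℂ) (m n : ℕ) :
    br q p s (m + n) = br q p s m * br q (p * q ^ m) s n := by
  simp [br, prod_range_add, pow_add, mul_assoc]

theorem qPoch_ne_zero {q x : ℂ} (h : ∀ n : ℕ, x * q ^ n ≠ 1) (n : ℕ) : qPoch q x n ≠ 0 :=
  prod_ne_zero_iff.2 fun i _ => sub_ne_zero.2 (h i).symm

theorem mul_pow_ne_one {q : ℂ} (hq : ‖q‖ < 1) (n : ℕ) : q * q ^ n ≠ 1 := by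
  intro h
  have h1 : ‖q‖ ^ (n + 1) = 1 := by rw [← norm_pow, pow_succ', h, norm_one]
  exact absurd h1 (pow_lt_one₀ (norm_nonneg _) hq (by omega)).ne

/-! ### The Pfaff–Saalschütz sum and the Bailey lemma -/

/-- The `q`-Pfaff–Saalschütz sum in homogeneous form. -/
theorem pfaff_saalschutz {q : ℂ} (hq : ‖q‖ < 1) (x s t p : ℂ)
    (hx : ∀ n : ℕ, x * p ^ 2 * q ^ n ≠ 1) (N : ℕ) :
    ∑ m ∈ range (N + 1), br q p s m * br q p t m * x ^ m * qPoch q (x * s * t) (N - m)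
        / (qPoch q q m * qPoch q q (N - m) * qPoch q (x * p ^ 2) m)
      = qPoch q (x * p * s) N * qPoch q (x * p * t) N
        / (qPoch q q N * qPoch q (x * p ^ 2) N) := by
  have h1 := qPoch_ne_zero (mul_pow_ne_one hq)
  have h2 := qPoch_ne_zero hx
  have h3 : ∀ n, 1 - q * q ^ n ≠ 0 := fun n => sub_ne_zero.2 (mul_pow_ne_one hq n).symm
  have h4 : ∀ n, 1 - x * p ^ 2 * q ^ n ≠ 0 := fun n => sub_ne_zero.2 (hx n).symm
  induction N with
  | zero => simp [br_zero, qPoch_zero]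
  | succ N ih =>
    set T : ℕ → ℕ → ℂ := fun N m => br q p s m * br q p t m * x ^ m * qPoch q (x * s * t) (N - m)
        / (qPoch q q m * qPoch q q (N - m) * qPoch q (x * p ^ 2) m) with hT
    -- Creative telescoping in `N`: `G` is the certificate. The case split sets `G 0 = 0` and avoids
    -- an index `m - 1`.
    let G : ℕ → ℂ := fun m => Nat.casesOn m 0 fun m =>
      -(q ^ (N - m) * br q p s (m + 1) * br q p t (m + 1) * x ^ (m + 1)
        * qPoch q (x * s * t) (N - m)
        / (qPoch q q m * qPoch q q (N - m) * qPoch q (x * p ^ 2) m))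
    have key : ∀ m ∈ range (N + 1),
        (1 - q * q ^ N) * (1 - x * p ^ 2 * q ^ N) * T (N + 1) m
          - (1 - x * p * s * q ^ N) * (1 - x * p * t * q ^ N) * T N m = G (m + 1) - G m := by
      intro m hm
      obtain ⟨l, rfl⟩ := Nat.exists_eq_add_of_le (Nat.lt_succ_iff.1 (mem_range.1 hm))
      have e1 : m + l + 1 - m = l + 1 := by omega
      have e2 : m + l - m = l := by omega
      rcases m with _ | m
      · simp only [hT, G, e1, e2, br_succ, qPoch_succ, br_zero, qPoch_zero]
        have := h3 l
        have := h1 l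
        simp
        field_simp
        ring
      · have e3 : m + 1 + l - m = l + 1 := by omega
        simp only [hT, G, e1, e2, e3, br_succ, qPoch_succ]
        have := h3 l
        have := h1 l
        have := h1 m
        have := h2 m
        have := h3 m
        have := h4 m
        field_simp
        ring
    have hs := sum_congr rfl key
    rw [sum_range_sub, sum_sub_distrib, ← mul_sum, ← mul_sum, ih] at hs
    -- The term `m = N + 1` has no counterpart in the sum for `N`; it cancels the boundary value
    -- left by telescoping.
    have hlast : (1 - q * q ^ N) * (1 - x * p ^ 2 * q ^ N) * T (N + 1) (N + 1) = - G (N + 1) := by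
      simp only [hT, G, Nat.sub_self, qPoch_succ, qPoch_zero]
      have := h1 N
      have := h2 N
      have := h3 N
      have := h4 N
      generalize 1 - x * p ^ 2 * q ^ N = d at *
      generalize 1 - q * q ^ N = d' at *
      field_simp
    rw [sum_range_succ]
    have hA : (1 - q * q ^ N) * (1 - x * p ^ 2 * q ^ N) ≠ 0 := mul_ne_zero (h3 N) (h4 N)
    apply mul_left_cancel₀ hA
    rw [mul_add, hlast]
    have hG0 : G 0 = 0 := rfl
    rw [hG0, sub_zero, sub_eq_iff_eq_add] at hs
    rw [hs]
    simp only [qPoch_succ]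
    have := h1 N
    have := h2 N
    have := h3 N
    have := h4 N
    clear key hlast ih hA
    generalize hd : 1 - x * p ^ 2 * q ^ N = d at *
    generalize hd' : 1 - q * q ^ N = d' at *
    field_simp
    ring

/-- The Bailey lemma. -/
theorem IsBailey.step {q x s t : ℂ} {α β : ℕ → ℂ} (h : IsBailey q x α β) (hq : ‖q‖ < 1)
    (hx : ∀ n : ℕ, x * q ^ n ≠ 1) (hs : ∀ n : ℕ, x * s * q ^ n ≠ 1)
    (ht : ∀ n : ℕ, x * t * q ^ n ≠ 1) :
    IsBailey q x (fun j => α j * mult q x s t j)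
      (fun n => ∑ l ∈ range (n + 1), kern q x s t n l * β l) := by
  intro n
  have e : ∀ l ∈ range (n + 1), kern q x s t n l * β l = ∑ j ∈ range (l + 1),
      kern q x s t n l * (α j / (qPoch q q (l - j) * qPoch q x (l + j))) := by
    intro l _
    rw [h l, mul_sum]
  beta_reduce
  -- After exchanging the sums, the inner sum over `l = j + m` is the Pfaff–Saalschütz sum with `p =
  -- q^j` and `N = n - j`.
  rw [sum_congr rfl e, sum_comm' (t' := range (n + 1)) (s' := fun j => Ico j (n + 1))
    (by intro x y; simp only [mem_range, mem_Ico]; omega)]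
  refine sum_congr rfl fun j hj => ?_
  obtain ⟨N, rfl⟩ := Nat.exists_eq_add_of_le (Nat.lt_succ_iff.1 (mem_range.1 hj))
  have hx2 : ∀ n : ℕ, x * (q ^ j) ^ 2 * q ^ n ≠ 1 := fun n => by
    have := hx (j * 2 + n)
    rwa [pow_add, pow_mul, ← mul_assoc] at this
  have ps := pfaff_saalschutz hq x s t (q ^ j) hx2 N
  have h1 := qPoch_ne_zero (mul_pow_ne_one hq)
  have h2 := qPoch_ne_zero hx2
  have h3 := qPoch_ne_zero hx
  have h4 := qPoch_ne_zero hs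
  have h5 := qPoch_ne_zero ht
  rw [sum_Ico_eq_sum_range, show j + N + 1 - j = N + 1 by omega]
  have e2 : ∀ m ∈ range (N + 1), kern q x s t (j + N) (j + m)
        * (α j / (qPoch q q (j + m - j) * qPoch q x (j + m + j)))
      = α j * br q 1 s j * br q 1 t j * x ^ j
          / (qPoch q (x * s) (j + N) * qPoch q (x * t) (j + N) * qPoch q x (j * 2))
        * (br q (q ^ j) s m * br q (q ^ j) t m * x ^ m * qPoch q (x * s * t) (N - m)
        / (qPoch q q m * qPoch q q (N - m) * qPoch q (x * (q ^ j) ^ 2) m)) := by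
    intro m hm
    obtain ⟨l, rfl⟩ := Nat.exists_eq_add_of_le (Nat.lt_succ_iff.1 (mem_range.1 hm))
    rw [kern, show j + (m + l) - (j + m) = l by omega, show j + m - j = m by omega,
      show m + l - m = l by omega, show j + m + j = j * 2 + m by omega, qPoch_add q x, br_add,
      br_add, one_mul, pow_mul, pow_add]
    have := h1 m
    have := h1 l
    have := h2 m
    have := h3 (j * 2)
    have := h4 (j + (m + l))
    have := h5 (j + (m + l))
    field_simp
  rw [sum_congr rfl e2, ← mul_sum, ps, mult, show j + N - j = N by omega,
    show j + N + j = j * 2 + N by omega, qPoch_add q x (j * 2), pow_mul]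
  have e3 : qPoch q (x * s) (j + N) = qPoch q (x * s) j * qPoch q (x * q ^ j * s) N := by
    rw [qPoch_add, mul_right_comm]
  have e4 : qPoch q (x * t) (j + N) = qPoch q (x * t) j * qPoch q (x * q ^ j * t) N := by
    rw [qPoch_add, mul_right_comm]
  have h6 := h4 (j + N)
  have h7 := h5 (j + N)
  rw [e3] at h6 ⊢
  rw [e4] at h7 ⊢
  have := left_ne_zero_of_mul h6
  have := right_ne_zero_of_mul h6
  have := left_ne_zero_of_mul h7
  have := right_ne_zero_of_mul h7
  have := h1 N
  have := h2 N
  have := h3 (j * 2)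
  generalize qPoch q (x * q ^ j * s) N = A at *
  generalize qPoch q (x * q ^ j * t) N = B at *
  field_simp

/-! ### Change of the base parameter and the unit pair -/

/-- Passing from a Bailey pair relative to `a` to one relative to `a / q`. -/
theorem IsBailey.change {q a : ℂ} {γ β : ℕ → ℂ} (hq : ‖q‖ < 1) (ha : ∀ n : ℕ, a * q ^ n ≠ 1)
    (h : IsBailey q (a * q) (fun j => (1 - a * q ^ (2 * j)) / (1 - a) * γ j) β) :
    IsBailey q a (fun j => q ^ j * γ j - if j = 0 then 0 else q ^ (j - 1) * γ (j - 1))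
      (fun n => q ^ n * β n) := by
  intro n
  have h1 := qPoch_ne_zero (mul_pow_ne_one hq)
  have h3 : ∀ n, 1 - q * q ^ n ≠ 0 := fun n => sub_ne_zero.2 (mul_pow_ne_one hq n).symm
  have h2 := qPoch_ne_zero ha
  have h4 : ∀ n, 1 - a * q ^ n ≠ 0 := fun n => sub_ne_zero.2 (ha n).symm
  have ha1 : 1 - a ≠ 0 := by simpa using h4 0
  simp only [sub_div]
  rw [sum_sub_distrib, sum_range_succ' (fun j => (if j = 0 then (0 : ℂ) else _) / _)]
  simp only [Nat.add_eq_zero_iff, one_ne_zero, and_false, if_false, if_true, zero_div, add_zero,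
    Nat.add_sub_cancel]
  rw [sum_range_succ, h n, mul_sum, sum_range_succ, add_sub_right_comm, ← sum_sub_distrib]
  have e : ∀ j, qPoch q (a * q) j = qPoch q a (j + 1) / (1 - a) := fun j => by
    rw [qPoch_succ']; field_simp
  congr 1
  -- The coefficients of `γ_j` agree because `(1 - a q^{n+j}) - (1 - q^{n-j}) = q^{n-j} (1 - a
  -- q^{2j})`. The case `j = n` is separate, since there the shifted term is absent.
  · refine sum_congr rfl fun j hj => ?_
    obtain ⟨l, rfl⟩ := Nat.exists_eq_add_of_lt (mem_range.1 hj)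
    rw [show j + l + 1 - j = l + 1 by omega, show j + l + 1 - (j + 1) = l by omega, e,
      show j + l + 1 + (j + 1) = j + l + 1 + j + 1 by omega, qPoch_succ q q, qPoch_succ q a]
    have := h1 l
    have := h3 l
    have := h2 (j + l + 1 + j)
    have := h4 (j + l + 1 + j)
    field_simp
    ring
  · rw [e, qPoch_succ q a, ← two_mul]
    have := h1 0
    have := h2 (2 * n)
    have := h4 (2 * n)
    rw [Nat.sub_self]
    field_simp

/-- The unit Bailey pair relative to `a`. -/
theorem isBailey_unit {q a : ℂ} (hq : ‖q‖ < 1) (ha : ∀ n : ℕ, a * q ^ n ≠ 1) :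
    IsBailey q (a * q)
      (fun j => (1 - a * q ^ (2 * j)) / (1 - a) * (qPoch q a j * br q 1 0 j / qPoch q q j))
      (fun n => if n = 0 then 1 else 0) := by
  intro n
  have h1 := qPoch_ne_zero (mul_pow_ne_one hq)
  have h3 : ∀ n, 1 - q * q ^ n ≠ 0 := fun n => sub_ne_zero.2 (mul_pow_ne_one hq n).symm
  have h2 := qPoch_ne_zero ha
  have h4 : ∀ n, 1 - a * q ^ n ≠ 0 := fun n => sub_ne_zero.2 (ha n).symm
  have ha1 : 1 - a ≠ 0 := by simpa using h4 0
  have e : ∀ j, qPoch q (a * q) j = qPoch q a (j + 1) / (1 - a) := fun j => by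
    rw [qPoch_succ']; field_simp
  rcases n with _ | n
  · simp [qPoch_zero, br_zero, ha1]
  beta_reduce
  rw [if_neg (by omega)]
  -- The partial sums have a closed form, found by induction on `M`. It is used up to `M = n`; the
  -- remaining term `j = n + 1` then cancels it.
  have part : ∀ M ≤ n, ∑ j ∈ range (M + 1),
      (1 - a * q ^ (2 * j)) / (1 - a) * (qPoch q a j * br q 1 0 j / qPoch q q j)
        / (qPoch q q (n + 1 - j) * qPoch q (a * q) (n + 1 + j))
      = q ^ M * br q 1 0 M * qPoch q a (M + 1)
        / (qPoch q q M * qPoch q q (n - M) * qPoch q a (n + 1 + M + 1) * (1 - q * q ^ n)) := by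
    intro M
    induction M with
    | zero =>
      intro _
      simp only [zero_add, sum_range_one, e, br_zero, qPoch_zero, Nat.sub_zero, Nat.add_zero,
        qPoch_succ q q n, qPoch_succ q a 0]
      have := h1 n
      have := h3 n
      have := h2 (n + 1 + 1)
      field_simp
      simp
    | succ M ih =>
      intro hM
      obtain ⟨l, rfl⟩ := Nat.exists_eq_add_of_le hM
      rw [sum_range_succ, ih (by omega), e, show M + 1 + l + 1 - (M + 1) = l + 1 by omega,
        show M + 1 + l - M = l + 1 by omega, show M + 1 + l - (M + 1) = l by omega,
        show M + 1 + l + 1 + (M + 1) + 1 = (M + 1 + l + 1 + M + 1) + 1 by omega,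
        qPoch_succ q a (M + 1 + l + 1 + M + 1), qPoch_succ q a (M + 1), qPoch_succ q q M,
        qPoch_succ q q l, br_succ]
      have := h1 l
      have := h3 l
      have := h1 M
      have := h3 M
      have := h3 (M + 1 + l)
      have := h2 (M + 1 + l + 1 + M + 1)
      have := h4 (M + 1 + l + 1 + M + 1)
      clear ih
      generalize hd : 1 - a * q ^ (M + 1 + l + 1 + M + 1) = d at *
      generalize hd' : 1 - q * q ^ M = d' at *
      generalize hd₁ : 1 - q * q ^ l = d₁ at *
      generalize hd₂ : 1 - q * q ^ (M + 1 + l) = d₂ at *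
      field_simp
      rw [← hd, ← hd', ← hd₁, ← hd₂]
      ring
  rw [sum_range_succ, part n le_rfl, e, Nat.sub_self, Nat.sub_self, qPoch_zero, qPoch_succ q q n,
    show n + 1 + (n + 1) + 1 = (n + 1 + n + 1) + 1 by omega, qPoch_succ q a (n + 1 + n + 1),
    br_succ]
  have := h1 n
  have := h3 n
  have := h2 (n + 1 + n + 1)
  have := h4 (n + 1 + n + 1)
  field_simp
  ring

/-! ### Growth and decay of sequences -/

/-- Growth at most exponential. -/
def ExpBdd (f : ℕ → ℂ) : Prop := ∃ C M : ℝ, 0 ≤ C ∧ 1 ≤ M ∧ ∀ n, ‖f n‖ ≤ C * M ^ n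

/-- Decay faster than any exponential. -/
def SuperDecay (f : ℕ → ℂ) : Prop := ∀ ρ : ℝ, 0 < ρ → ∃ C : ℝ, 0 ≤ C ∧ ∀ n, ‖f n‖ ≤ C * ρ ^ n

theorem ExpBdd.mul {f g : ℕ → ℂ} (hf : ExpBdd f) (hg : ExpBdd g) :
    ExpBdd (fun n => f n * g n) := by
  obtain ⟨C, M, hC, hM, h⟩ := hf
  obtain ⟨D, N, hD, hN, h'⟩ := hg
  refine ⟨C * D, M * N, by positivity, by nlinarith, fun n => ?_⟩
  rw [norm_mul, mul_pow]
  calc _ ≤ (C * M ^ n) * (D * N ^ n) := by gcongr <;> [exact h n; exact h' n]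
    _ = _ := by ring

theorem ExpBdd.add {f g : ℕ → ℂ} (hf : ExpBdd f) (hg : ExpBdd g) :
    ExpBdd (fun n => f n + g n) := by
  obtain ⟨C, M, hC, hM, h⟩ := hf
  obtain ⟨D, N, hD, hN, h'⟩ := hg
  refine ⟨C + D, max M N, by positivity, le_max_of_le_left hM, fun n => ?_⟩
  calc _ ≤ ‖f n‖ + ‖g n‖ := norm_add_le _ _
    _ ≤ C * M ^ n + D * N ^ n := add_le_add (h n) (h' n)
    _ ≤ C * (max M N) ^ n + D * (max M N) ^ n := by
      gcongr <;> [exact le_max_left _ _; exact le_max_right _ _]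
    _ = _ := by ring

theorem ExpBdd.prod_range {g : ℕ → ℂ} {M : ℝ} (h : ∀ i, ‖g i‖ ≤ M) :
    ExpBdd (fun n => ∏ i ∈ range n, g i) := by
  refine ⟨1, max M 1, by norm_num, le_max_right _ _, fun n => ?_⟩
  rw [norm_prod, one_mul, ← card_range n, ← prod_const, card_range]
  exact prod_le_prod (fun _ _ => norm_nonneg _) fun i _ => (h i).trans (le_max_left _ _)

theorem ExpBdd.of_bdd {f : ℕ → ℂ} {C : ℝ} (h : ∀ n, ‖f n‖ ≤ C) : ExpBdd f :=
  ⟨C, 1, (norm_nonneg _).trans (h 0), le_rfl, fun n => by simpa using h n⟩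

theorem ExpBdd.const (c : ℂ) : ExpBdd (fun _ => c) := .of_bdd fun _ => le_rfl

theorem ExpBdd.pow (c : ℂ) : ExpBdd (fun n => c ^ n) := by
  simpa using ExpBdd.prod_range (g := fun _ => c) (M := ‖c‖) fun _ => le_rfl

theorem ExpBdd.finset_prod {ι : Type*} (S : Finset ι) {f : ι → ℕ → ℂ}
    (h : ∀ i ∈ S, ExpBdd (f i)) : ExpBdd (fun n => ∏ i ∈ S, f i n) := by
  classical
  induction S using Finset.induction_on with
  | empty => simpa using ExpBdd.const 1
  | insert i S hi ih =>
    simp only [prod_insert hi]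
    exact (h i (mem_insert_self _ _)).mul (ih fun j hj => h j (mem_insert_of_mem hj))

theorem ExpBdd.shift {f : ℕ → ℂ} (h : ExpBdd f) : ExpBdd (fun n => f (n + 1)) := by
  obtain ⟨C, M, hC, hM, h⟩ := h
  exact ⟨C * M, M, by positivity, hM, fun n => (h _).trans_eq (by ring)⟩

theorem ExpBdd.of_tendsto {f : ℕ → ℂ} {l : ℂ} (h : Tendsto f atTop (𝓝 l)) : ExpBdd f := by
  obtain ⟨C, hC⟩ := h.norm.bddAbove_range
  exact .of_bdd fun n => hC ⟨n, rfl⟩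

theorem SuperDecay.mul_expBdd {f g : ℕ → ℂ} (hf : SuperDecay f) (hg : ExpBdd g) :
    SuperDecay (fun n => f n * g n) := by
  intro ρ hρ
  obtain ⟨D, N, hD, hN, h'⟩ := hg
  obtain ⟨C, hC, h⟩ := hf (ρ / N) (by positivity)
  refine ⟨C * D, by positivity, fun n => ?_⟩
  rw [norm_mul]
  calc _ ≤ (C * (ρ / N) ^ n) * (D * N ^ n) := by gcongr <;> [exact h n; exact h' n]
    _ = C * D * (ρ / N * N) ^ n := by rw [mul_pow]; ring
    _ = _ := by rw [div_mul_cancel₀ _ (by positivity)]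

theorem SuperDecay.summable {f : ℕ → ℂ} (hf : SuperDecay f) : Summable f := by
  obtain ⟨C, _, h⟩ := hf (1 / 2) (by norm_num)
  exact .of_norm_bounded (summable_geometric_two.mul_left C) h

/-- If the factors of a product are eventually at most `ρ`, the product is `O(ρ^n)`. -/
theorem prod_le_const_mul_pow {g : ℕ → ℝ} (hg : ∀ i, 0 ≤ g i) {ρ : ℝ} (hρ : 0 < ρ)
    (h : ∀ᶠ i in atTop, g i ≤ ρ) : ∃ C : ℝ, 0 ≤ C ∧ ∀ n, ∏ i ∈ range n, g i ≤ C * ρ ^ n := by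
  obtain ⟨N, hN⟩ := eventually_atTop.1 h
  -- The normalized product is nonincreasing from `N` on, so the sum of its first `N + 1` values
  -- bounds it everywhere.
  set u : ℕ → ℝ := fun n => (∏ i ∈ range n, g i) / ρ ^ n with hu
  have hu0 : ∀ n, 0 ≤ u n := fun n => div_nonneg (prod_nonneg fun i _ => hg i) (by positivity)
  have hb : ∀ n ≤ N, u n ≤ ∑ i ∈ range (N + 1), u i := fun n hn =>
    single_le_sum (fun i _ => hu0 i) (mem_range.2 (by omega))
  refine ⟨∑ i ∈ range (N + 1), u i, sum_nonneg fun i _ => hu0 i, fun n => ?_⟩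
  rw [← div_le_iff₀ (by positivity)]
  change u n ≤ _
  rcases le_total n N with hn | hn
  · exact hb n hn
  · induction n, hn using Nat.le_induction with
    | base => exact hb N le_rfl
    | succ n hn ih =>
      refine le_trans ?_ ih
      have : u (n + 1) = u n * (g n / ρ) := by
        simp only [hu, prod_range_succ, pow_succ]; field_simp
      rw [this]
      exact mul_le_of_le_one_right (hu0 n) ((div_le_one hρ).2 (hN n hn))

theorem norm_qpow_le {q : ℂ} (hq : ‖q‖ < 1) (i : ℕ) : ‖q ^ i‖ ≤ 1 := by
  rw [norm_pow]; exact pow_le_one₀ (norm_nonneg _) hq.le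

theorem expBdd_qPoch {q : ℂ} (hq : ‖q‖ < 1) (x : ℂ) : ExpBdd (qPoch q x) := by
  refine ExpBdd.prod_range (g := fun i => 1 - x * q ^ i) (M := 1 + ‖x‖) fun i => ?_
  refine (norm_sub_le _ _).trans ?_
  rw [norm_one, norm_mul]
  gcongr
  exact mul_le_of_le_one_right (norm_nonneg _) (norm_qpow_le hq i)

theorem expBdd_br {q : ℂ} (hq : ‖q‖ < 1) (p s : ℂ) : ExpBdd (br q p s) := by
  refine ExpBdd.prod_range (g := fun i => s - p * q ^ i) (M := ‖s‖ + ‖p‖) fun i => ?_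
  refine (norm_sub_le _ _).trans ?_
  rw [norm_mul]
  gcongr
  exact mul_le_of_le_one_right (norm_nonneg _) (norm_qpow_le hq i)

theorem tendsto_one_sub {q : ℂ} (hq : ‖q‖ < 1) (x : ℂ) :
    Tendsto (fun i : ℕ => 1 - x * q ^ i) atTop (𝓝 1) := by
  simpa using ((tendsto_pow_atTop_nhds_zero_of_norm_lt_one hq).const_mul x).const_sub 1

/-- The factors `(1 - x q^i)⁻¹` tend to `1` and are therefore bounded. A vanishing factor does no
harm because `0⁻¹ = 0`. -/
theorem expBdd_qPoch_inv {q x : ℂ} (hq : ‖q‖ < 1) :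
    ExpBdd (fun n => (qPoch q x n)⁻¹) := by
  have := ((tendsto_one_sub hq x).inv₀ one_ne_zero).norm
  obtain ⟨C, hC⟩ := this.bddAbove_range
  simp only [qPoch, ← prod_inv_distrib]
  exact .prod_range fun i => hC ⟨i, rfl⟩

theorem superDecay_br {q : ℂ} (hq : ‖q‖ < 1) : SuperDecay (br q 1 0) := by
  intro ρ hρ
  have : Tendsto (fun i : ℕ => ‖(0 : ℂ) - 1 * q ^ i‖) atTop (𝓝 0) := by
    simpa using tendsto_pow_atTop_nhds_zero_of_lt_one (norm_nonneg q) hq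
  obtain ⟨C, hC, h⟩ := prod_le_const_mul_pow (fun i => norm_nonneg _) hρ
    (this.eventually_le_const hρ)
  exact ⟨C, hC, fun n => by rw [br, norm_prod]; exact h n⟩

/-! ### Infinite products and the limit of the Bailey lemma -/

theorem summable_norm_qpow {q : ℂ} (hq : ‖q‖ < 1) (x : ℂ) :
    Summable fun i : ℕ => ‖-(x * q ^ i)‖ := by
  simp only [norm_neg, norm_mul, norm_pow]
  exact (summable_geometric_of_lt_one (norm_nonneg _) hq).mul_left _

theorem tendsto_qPoch {q : ℂ} (hq : ‖q‖ < 1) (x : ℂ) :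
    Tendsto (qPoch q x) atTop (𝓝 (qPochInf q x)) := by
  have := (multipliable_one_add_of_summable (summable_norm_qpow hq x)).hasProd.tendsto_prod_nat
  simp only [← sub_eq_add_neg] at this
  exact this

theorem qPochInf_ne_zero {q x : ℂ} (hq : ‖q‖ < 1) (h : ∀ n : ℕ, x * q ^ n ≠ 1) :
    qPochInf q x ≠ 0 := by
  have := tprod_one_add_ne_zero_of_summable (f := fun i : ℕ => -(x * q ^ i))
    (fun i => by rw [← sub_eq_add_neg]; exact sub_ne_zero.2 (h i).symm) (summable_norm_qpow hq x)
  simp only [← sub_eq_add_neg] at this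
  exact this

/-- Tannery's theorem: the truncated sums are extended by zero and dominated by `‖f j‖ * C`. -/
theorem tendsto_sum_range_mul {f : ℕ → ℂ} {g : ℕ → ℕ → ℂ} {L : ℂ} {C : ℝ} (hf : Summable f)
    (hb : ∀ n j, ‖g n j‖ ≤ C) (hg : ∀ j, Tendsto (fun n => g n j) atTop (𝓝 L)) :
    Tendsto (fun n => ∑ j ∈ range (n + 1), f j * g n j) atTop (𝓝 ((∑' j, f j) * L)) := by
  rw [← tsum_mul_right]
  have h := tendsto_tsum_of_dominated_convergence (𝓕 := atTop)
    (f := fun n j => if j ∈ range (n + 1) then f j * g n j else 0) (g := fun j => f j * L)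
    (bound := fun j => ‖f j‖ * C) (hf.norm.mul_right C) (fun j => ?_) (.of_forall fun n j => ?_)
  · refine h.congr fun n => ?_
    rw [tsum_eq_sum (s := range (n + 1)) fun j hj => if_neg hj]
    exact sum_congr rfl fun j hj => if_pos hj
  · refine ((hg j).const_mul (f j)).congr' ?_
    filter_upwards [eventually_ge_atTop j] with n hn
    rw [if_pos (mem_range.2 (by omega))]
  · split_ifs
    · rw [norm_mul]; gcongr; exact hb n j
    · rw [norm_zero]; exact mul_nonneg (norm_nonneg _) ((norm_nonneg _).trans (hb 0 0))

theorem qPoch_zero_right (q : ℂ) (n : ℕ) : qPoch q 0 n = 1 := by simp [qPoch]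

/-- The Bailey lemma with `ρ₂ → ∞` and `n → ∞`. -/
theorem IsBailey.tsum_eq {q a s : ℂ} {α β : ℕ → ℂ} (h : IsBailey q a α β) (hq : ‖q‖ < 1)
    (ha : ∀ n : ℕ, a * q ^ n ≠ 1) (hs : ∀ n : ℕ, a * s * q ^ n ≠ 1)
    (hβ : Summable fun n => br q 1 s n * br q 1 0 n * a ^ n * β n)
    (hα : Summable fun n => α n * mult q a s 0 n) :
    ∑' n, br q 1 s n * br q 1 0 n * a ^ n * β n
      = qPochInf q (a * s) / qPochInf q a * ∑' n, α n * mult q a s 0 n := by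
  have hstep := h.step (t := 0) hq ha hs (by simp)
  have tq := (tendsto_qPoch hq q).inv₀ (qPochInf_ne_zero hq (mul_pow_ne_one hq))
  have ta := (tendsto_qPoch hq a).inv₀ (qPochInf_ne_zero hq ha)
  have ts := tendsto_qPoch hq (a * s)
  obtain ⟨Cq, hCq⟩ := tq.norm.bddAbove_range
  obtain ⟨Ca, hCa⟩ := ta.norm.bddAbove_range
  obtain ⟨Cs, hCs⟩ := ts.norm.bddAbove_range
  have hCq : ∀ n, ‖(qPoch q q n)⁻¹‖ ≤ Cq := fun n => hCq ⟨n, rfl⟩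
  have hCa : ∀ n, ‖(qPoch q a n)⁻¹‖ ≤ Ca := fun n => hCa ⟨n, rfl⟩
  have hCs : ∀ n, ‖qPoch q (a * s) n‖ ≤ Cs := fun n => hCs ⟨n, rfl⟩
  have p1 := (norm_nonneg _).trans (hCq 0)
  have p2 := (norm_nonneg _).trans (hCa 0)
  have p3 := (norm_nonneg _).trans (hCs 0)
  -- Both sides of the Bailey lemma, multiplied by `(as)_n`, converge as `n → ∞`. The common factor
  -- `1 / (q)_∞` cancels afterwards.
  have l1 := tendsto_sum_range_mul hβ (g := fun n j => (qPoch q q (n - j))⁻¹)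
    (fun n j => hCq _) (fun j => tq.comp (tendsto_sub_atTop_nat j))
  have l2 := tendsto_sum_range_mul hα
    (g := fun n j => qPoch q (a * s) n * (qPoch q q (n - j))⁻¹ * (qPoch q a (n + j))⁻¹)
    (C := Cs * Cq * Ca)
    (fun n j => by
      rw [norm_mul, norm_mul]
      gcongr <;> [exact hCs _; exact hCq _; exact hCa _])
    (fun j => (ts.mul (tq.comp (tendsto_sub_atTop_nat j))).mul
      (ta.comp (tendsto_add_atTop_nat j)))
  have e := tendsto_nhds_unique (l1.congr fun n => ?_) l2
  · have := qPochInf_ne_zero hq (mul_pow_ne_one hq)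
    have := qPochInf_ne_zero hq ha
    field_simp at e ⊢
    linear_combination e
  · have hn := hstep n
    have hsn := qPoch_ne_zero hs n
    have : ∀ l ∈ range (n + 1), br q 1 s l * br q 1 0 l * a ^ l * β l * (qPoch q q (n - l))⁻¹
        = qPoch q (a * s) n * (kern q a s 0 n l * β l) := fun l _ => by
      have := qPoch_ne_zero (mul_pow_ne_one hq) (n - l)
      simp only [kern, mul_zero, qPoch_zero_right]
      field_simp
    rw [sum_congr rfl this, ← mul_sum]
    beta_reduce at hn
    rw [hn, mul_sum]
    refine sum_congr rfl fun j _ => ?_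
    rw [div_eq_mul_inv, mul_inv]
    ring

/-! ### Chains and nested sums -/

/-- The chain with entries `e 0 ≥ e 1 ≥ ⋯ ≥ e (m - 1)`. -/
def Chain.ofSeq (m : ℕ) (e : ℕ → ℕ) (he : Antitone e) : Chain m :=
  ⟨fun i => e i, fun _ _ h => he h⟩

theorem Chain.entry_succ_of_lt {m : ℕ} (s : Chain m) {i : ℕ} (h : i < m) :
    s.entry (i + 1) = s.1 ⟨i, h⟩ := by
  rw [Chain.entry, dif_pos ⟨by omega, by omega⟩]; rfl

theorem Chain.entry_of_lt {m : ℕ} (s : Chain m) {i : ℕ} (h : m < i) : s.entry i = 0 := by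
  rw [Chain.entry, dif_neg (by omega)]

theorem Chain.entry_ofSeq {m : ℕ} {e : ℕ → ℕ} (he : Antitone e) (i : ℕ) (h : i < m) :
    (Chain.ofSeq m e he).entry (i + 1) = e i := Chain.entry_succ_of_lt _ h

theorem Chain.ext_entry {m : ℕ} {s t : Chain m} (h : ∀ i < m, s.entry (i + 1) = t.entry (i + 1)) :
    s = t := by
  refine Subtype.ext (funext fun i => ?_)
  have := h i i.2
  rwa [s.entry_succ_of_lt i.2, t.entry_succ_of_lt i.2] at this

theorem Chain.antitone_entry {m : ℕ} (s : Chain m) : Antitone fun i => s.entry (i + 1) := by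
  intro i j hij
  beta_reduce
  rcases lt_or_ge j m with h | h
  · rw [s.entry_succ_of_lt h, s.entry_succ_of_lt (hij.trans_lt h)]
    exact s.2 hij
  · rw [s.entry_of_lt (by omega)]; exact Nat.zero_le _

/-- The nested finite sum `∑_{n ≥ s_1 ≥ ⋯ ≥ s_m = 0} K_0(n, s_1) K_1(s_1, s_2) ⋯`. -/
def chainSum : ℕ → (ℕ → ℕ → ℕ → ℂ) → ℕ → ℂ
  | 0, _, n => if n = 0 then 1 else 0
  | m + 1, K, n => ∑ j ∈ range (n + 1), K 0 n j * chainSum m (fun i => K (i + 1)) j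

/-- The product of kernels along a chain. -/
def chainProd {m : ℕ} (K : ℕ → ℕ → ℕ → ℂ) (s : Chain m) : ℂ :=
  ∏ i ∈ range m, K i (s.entry (i + 1)) (s.entry (i + 2))

/-- The sequence `n, t_1, t_2, …`. -/
def consSeq {m : ℕ} (n : ℕ) (t : Chain m) : ℕ → ℕ
  | 0 => n
  | i + 1 => t.entry (i + 1)

theorem antitone_consSeq {m n : ℕ} {t : Chain m} (h : t.entry 1 ≤ n) :
    Antitone (consSeq n t) := by
  refine antitone_nat_of_succ_le fun i => ?_
  cases i with
  | zero => exact h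
  | succ i => exact t.antitone_entry (Nat.le_succ i)

/-- Prepending `n` to a chain with entries at most `n`. -/
def Chain.cons {m n : ℕ} (t : {t : Chain m // t.entry 1 ≤ n}) : Chain (m + 1) :=
  Chain.ofSeq (m + 1) (consSeq n t.1) (antitone_consSeq t.2)

theorem Chain.entry_cons {m n : ℕ} (t : {t : Chain m // t.entry 1 ≤ n}) (i : ℕ) :
    (Chain.cons t).entry (i + 2) = t.1.entry (i + 1) := by
  rcases lt_or_ge (i + 1) (m + 1) with h | h
  · exact Chain.entry_ofSeq _ (i + 1) h
  · rw [Chain.entry_of_lt _ (by omega), Chain.entry_of_lt _ (by omega)]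

theorem Chain.entry_one_cons {m n : ℕ} (t : {t : Chain m // t.entry 1 ≤ n}) :
    (Chain.cons t).entry 1 = n := Chain.entry_ofSeq _ 0 (Nat.succ_pos _)

theorem Chain.cons_injective {m n : ℕ} :
    Function.Injective (Chain.cons : {t : Chain m // t.entry 1 ≤ n} → Chain (m + 1)) := by
  intro t u h
  refine Subtype.ext (Chain.ext_entry fun i _ => ?_)
  rw [← Chain.entry_cons, ← Chain.entry_cons, h]

theorem Chain.mem_range_cons {m : ℕ} (s : Chain (m + 1)) :
    s ∈ Set.range (Chain.cons : {t : Chain m // t.entry 1 ≤ s.entry 1} → Chain (m + 1)) := by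
  have ha : Antitone fun i => s.entry (i + 2) := fun i j h => s.antitone_entry (Nat.succ_le_succ h)
  have he : ∀ i, (Chain.ofSeq m _ ha).entry (i + 1) = s.entry (i + 2) := fun i => by
    rcases lt_or_ge i m with h | h
    · exact Chain.entry_ofSeq ha i h
    · rw [Chain.entry_of_lt _ (by omega), Chain.entry_of_lt _ (by omega)]
  refine ⟨⟨Chain.ofSeq m _ ha, ?_⟩, Chain.ext_entry fun i _ => ?_⟩
  · rw [he 0]; exact s.antitone_entry (Nat.zero_le 1)
  · cases i with
    | zero => exact Chain.entry_one_cons _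
    | succ i => rw [Chain.entry_cons, he]

/-- Induction by splitting off the head: chains with head `n` correspond through `Chain.cons` to
chains with head at most `n`. For `m = 0` the convention that missing entries are `0` gives exactly
`δ_{n,0}`. -/
theorem hasSum_chainSum (m : ℕ) (K : ℕ → ℕ → ℕ → ℂ) (n : ℕ) :
    HasSum (fun s : Chain m => if s.entry 1 = n then chainProd K s else 0) (chainSum m K n) := by
  induction m generalizing K n with
  | zero =>
    have e : ∀ s : Chain 0, (if s.entry 1 = n then chainProd K s else 0) = chainSum 0 K n := by
      intro s
      rw [Chain.entry_of_lt s Nat.zero_lt_one]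
      simp [chainProd, chainSum, eq_comm]
    have s₀ : Chain 0 := Chain.ofSeq 0 0 fun _ _ _ => le_rfl
    have hs : ∀ s : Chain 0, s = s₀ := fun s => Chain.ext_entry fun i hi => absurd hi (by omega)
    simp only [e]
    refine hasSum_single (f := fun _ : Chain 0 => chainSum 0 K n) s₀ fun s h => absurd (hs s) h
  | succ m ih =>
    rw [← (Chain.cons_injective (m := m) (n := n)).hasSum_iff]
    · have h1 : HasSum (fun t : Chain m => ∑ j ∈ range (n + 1), K 0 n j *
          (if t.entry 1 = j then chainProd (fun i => K (i + 1)) t else 0)) (chainSum (m + 1) K n) :=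
        hasSum_sum fun j _ => (ih _ j).mul_left _
      refine ((hasSum_subtype_iff_of_support_subset
        (s := {t : Chain m | t.entry 1 ≤ n}) ?_).2 h1).congr_fun ?_
      · intro t ht
        by_contra hn
        refine ht (sum_eq_zero fun j hj => ?_)
        have := mem_range.1 hj
        rw [if_neg (by simp at hn; omega), mul_zero]
      · intro t
        simp only [Function.comp]
        rw [if_pos (Chain.entry_one_cons t), chainProd, prod_range_succ', Chain.entry_one_cons,
          Chain.entry_cons, sum_eq_single (t.1.entry 1), if_pos rfl, mul_comm]
        · simp only [chainProd, Chain.entry_cons]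
        · intro j _ hj
          rw [if_neg hj.symm, mul_zero]
        · intro h
          exact absurd (mem_range.2 (Nat.lt_succ_of_le t.2)) h
    · intro s hs
      refine if_neg fun h => hs ?_
      subst h
      exact s.mem_range_cons

theorem summable_prod_half (m : ℕ) :
    Summable fun x : Fin m → ℕ => ∏ i, (1 / 2 : ℝ) ^ x i := by
  induction m with
  | zero => exact (hasSum_fintype _).summable
  | succ m ih =>
    rw [← (Fin.consEquiv fun _ => ℕ).summable_iff]
    refine (summable_geometric_two.mul_of_nonneg ih (fun _ => by positivity)
      fun _ => by positivity).congr fun x => ?_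
    simp [Fin.prod_univ_succ, Fin.consEquiv, mul_comm]

/-- The first entry is the largest, so `(1/2)^{m s_1}` is at most `∏ (1/2)^{s_i}`, which is summable
even over all tuples. -/
theorem summable_chain_of_le {m : ℕ} {f : Chain m → ℂ} {C : ℝ}
    (h : ∀ s, ‖f s‖ ≤ C * ((1 / 2) ^ m) ^ s.entry 1) : Summable f := by
  have hC : 0 ≤ C := by
    by_contra hC
    have := (norm_nonneg _).trans (h (Chain.ofSeq m 0 fun _ _ _ => le_rfl))
    exact absurd this (not_le.2 (mul_neg_of_neg_of_pos (not_le.1 hC) (by positivity)))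
  refine .of_norm_bounded (((summable_prod_half m).comp_injective
    Subtype.val_injective).mul_left C) fun s => (h s).trans ?_
  gcongr
  rw [← pow_mul, mul_comm, pow_mul]
  calc _ = ∏ i : Fin m, (1 / 2 : ℝ) ^ s.entry 1 := by simp
    _ ≤ ∏ i : Fin m, (1 / 2 : ℝ) ^ s.1 i := by
      refine prod_le_prod (fun _ _ => by positivity) fun i _ => ?_
      refine pow_le_pow_of_le_one (by norm_num) (by norm_num) ?_
      rw [← s.entry_succ_of_lt i.2]
      exact s.antitone_entry (Nat.zero_le i)

/-- Summation over the fibres of `s ↦ s_1` lets an absolutely convergent multisum be read as a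
single sum of `β`. -/
theorem hasSum_head {m : ℕ} {W : ℕ → ℂ} {K : ℕ → ℕ → ℕ → ℂ}
    (h : Summable fun s : Chain m => W (s.entry 1) * chainProd K s) :
    HasSum (fun n => W n * chainSum m K n)
      (∑' s : Chain m, W (s.entry 1) * chainProd K s) := by
  refine (h.hasSum.tsum_fiberwise fun s => s.entry 1).congr_fun fun n => ?_
  rw [← (hasSum_chainSum m K n).tsum_eq, ← tsum_mul_left,
    tsum_subtype ((fun s : Chain m => s.entry 1) ⁻¹' {n})
      (fun s : Chain m => W (s.entry 1) * chainProd K s)]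
  refine tsum_congr fun s => ?_
  by_cases hs : s.entry 1 = n
  · rw [Set.indicator_of_mem (by exact hs), if_pos hs, hs]
  · rw [Set.indicator_of_notMem (by exact hs), if_neg hs, mul_zero]

theorem chainSum_congr {m : ℕ} {K K' : ℕ → ℕ → ℕ → ℂ} (h : ∀ i < m, K i = K' i) :
    chainSum m K = chainSum m K' := by
  induction m generalizing K K' with
  | zero => rfl
  | succ m ih =>
    funext n
    rw [chainSum, chainSum, h 0 (Nat.succ_pos _),
      ih (K := fun i => K (i + 1)) (K' := fun i => K' (i + 1)) fun i hi => h _ (by omega)]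

/-- The factor `q^n` from the change of parameter is absorbed into the outermost kernel. With no
kernel left, the sum is supported at `n = 0`, where the factor is `1`. -/
theorem chainSum_scale (q : ℂ) {m : ℕ} (K : ℕ → ℕ → ℕ → ℂ) (n : ℕ) :
    chainSum m (fun i n j => (if i = 0 then q ^ n else 1) * K i n j) n = q ^ n * chainSum m K n := by
  cases m with
  | zero => by_cases h : n = 0 <;> simp [chainSum, h]
  | succ m =>
    simp only [chainSum, if_true, Nat.add_eq_zero_iff, one_ne_zero, and_false, if_false, one_mul,
      mul_sum, mul_assoc]

/-! ### Iterating the Bailey lemma -/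

/-- Kernels are numbered from the outside, so kernel `0` is the last Bailey step applied and the
induction peels it off. -/
theorem IsBailey.chainSum {q x : ℂ} {m R : ℕ} {K : ℕ → ℕ → ℕ → ℂ} {σ τ α : ℕ → ℂ} (hq : ‖q‖ < 1)
    (hx : ∀ n : ℕ, x * q ^ n ≠ 1) (hσ : ∀ i < R, ∀ n : ℕ, x * σ i * q ^ n ≠ 1)
    (hτ : ∀ i < R, ∀ n : ℕ, x * τ i * q ^ n ≠ 1) (hK : ∀ i < R, K i = kern q x (σ i) (τ i))
    (h : IsBailey q x α (chainSum m fun i => K (R + i))) :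
    IsBailey q x (fun j => α j * ∏ i ∈ range R, mult q x (σ i) (τ i) j) (chainSum (m + R) K) := by
  induction R generalizing K σ τ with
  | zero => simpa using h
  | succ R ih =>
    have := ih (K := fun i => K (i + 1)) (σ := fun i => σ (i + 1)) (τ := fun i => τ (i + 1))
      (fun i hi => hσ _ (by omega)) (fun i hi => hτ _ (by omega)) (fun i hi => hK _ (by omega))
      (by convert h using 3 with i; congr 1; omega)
    have := this.step hq hx (hσ 0 (Nat.succ_pos _)) (hτ 0 (Nat.succ_pos _))
    rw [← hK 0 (Nat.succ_pos _)] at this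
    have e : (fun j => α j * ∏ i ∈ range (R + 1), mult q x (σ i) (τ i) j) = fun j =>
        (α j * ∏ i ∈ range R, mult q x (σ (i + 1)) (τ (i + 1)) j) * mult q x (σ 0) (τ 0) j := by
      funext j; rw [prod_range_succ', mul_assoc]
    rw [e]
    exact this

/-- The kernels of the chain: `R` of them relative to `a / q`, the others relative to `a`. -/
def fullKern (q a : ℂ) (R : ℕ) (σ τ : ℕ → ℂ) (i n j : ℕ) : ℂ :=
  if i < R then kern q a (σ i) (τ i) n j
  else (if i = R then q ^ n else 1) * kern q (a * q) (σ i) (τ i) n j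

/-- The non-telescoping part of `α` at the change from `a` to `a / q`. -/
def changeSeq (q a : ℂ) (R S : ℕ) (σ τ : ℕ → ℂ) (j : ℕ) : ℂ :=
  q ^ j * (qPoch q a j * br q 1 0 j / qPoch q q j
    * ∏ i ∈ range S, mult q (a * q) (σ (R + i)) (τ (R + i)) j)

theorem isBailey_fullKern {q a : ℂ} {R S : ℕ} {σ τ : ℕ → ℂ} (hq : ‖q‖ < 1)
    (ha : ∀ n : ℕ, a * q ^ n ≠ 1)
    (h1 : ∀ i < R, ∀ n : ℕ, a * σ i * q ^ n ≠ 1) (h2 : ∀ i < R, ∀ n : ℕ, a * τ i * q ^ n ≠ 1)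
    (h3 : ∀ i < S, ∀ n : ℕ, a * q * σ (R + i) * q ^ n ≠ 1)
    (h4 : ∀ i < S, ∀ n : ℕ, a * q * τ (R + i) * q ^ n ≠ 1) :
    IsBailey q a (fun j => (changeSeq q a R S σ τ j
        - if j = 0 then 0 else changeSeq q a R S σ τ (j - 1))
        * ∏ i ∈ range R, mult q a (σ i) (τ i) j)
      (chainSum (S + R) (fullKern q a R σ τ)) := by
  have haq : ∀ n : ℕ, a * q * q ^ n ≠ 1 := fun n => by
    have := ha (n + 1); rwa [pow_succ', ← mul_assoc] at this
  have u := isBailey_unit hq ha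
  -- At length `0` the nested sum is `δ_{n,0}` by definition, which is the `β` of the unit pair.
  have v := IsBailey.chainSum (m := 0) (K := fun i => kern q (a * q) (σ (R + i)) (τ (R + i)))
    hq haq h3 h4 (fun _ _ => rfl) u
  simp only [mul_assoc _ (_ / _)] at v
  have w := v.change hq ha
  refine IsBailey.chainSum hq ha h1 h2 (fun i hi => ?_) ?_
  · funext n j; rw [fullKern, if_pos hi]
  · refine Eq.subst (motive := IsBailey q a _) ?_ w
    funext n
    rw [← chainSum_scale, Nat.zero_add]
    refine congrFun (chainSum_congr fun i _ => ?_) n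
    funext n j
    simp [fullKern]

/-! ### Absolute convergence and summation by parts -/

theorem kern_le {q x s t : ℂ} (hq : ‖q‖ < 1) :
    ∃ C M : ℝ, 0 ≤ C ∧ 1 ≤ M ∧ ∀ n, ∀ j ≤ n, ‖kern q x s t n j‖ ≤ C * M ^ n := by
  obtain ⟨C₁, M₁, hC₁, hM₁, h₁⟩ := ((expBdd_br hq 1 s).mul (expBdd_br hq 1 t)).mul (.pow x)
  obtain ⟨C₂, M₂, hC₂, hM₂, h₂⟩ :=
    (expBdd_qPoch hq (x * s * t)).mul (expBdd_qPoch_inv (x := q) hq)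
  obtain ⟨C₃, M₃, hC₃, hM₃, h₃⟩ :=
    (expBdd_qPoch_inv (x := x * s) hq).mul (expBdd_qPoch_inv (x := x * t) hq)
  refine ⟨C₁ * C₂ * C₃, M₁ * M₂ * M₃, by positivity, ?_, fun n j hj => ?_⟩
  · exact one_le_mul_of_one_le_of_one_le (one_le_mul_of_one_le_of_one_le hM₁ hM₂) hM₃
  · have e : kern q x s t n j = (br q 1 s j * br q 1 t j * x ^ j)
        * (qPoch q (x * s * t) (n - j) * (qPoch q q (n - j))⁻¹)
        * ((qPoch q (x * s) n)⁻¹ * (qPoch q (x * t) n)⁻¹) := by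
      rw [kern, div_eq_mul_inv, mul_inv, mul_inv]; ring
    rw [e, norm_mul, norm_mul]
    calc _ ≤ (C₁ * M₁ ^ j) * (C₂ * M₂ ^ (n - j)) * (C₃ * M₃ ^ n) := by
          gcongr <;> [exact h₁ j; exact h₂ _; exact h₃ n]
      _ ≤ (C₁ * M₁ ^ n) * (C₂ * M₂ ^ n) * (C₃ * M₃ ^ n) := by
          (gcongr; omega)
      _ = _ := by ring

theorem fullKern_le {q a : ℂ} (hq : ‖q‖ < 1) (R : ℕ) (σ τ : ℕ → ℂ) (i : ℕ) :
    ∃ C M : ℝ, 0 ≤ C ∧ 1 ≤ M ∧ ∀ n, ∀ j ≤ n, ‖fullKern q a R σ τ i n j‖ ≤ C * M ^ n := by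
  by_cases hi : i < R
  · simp only [fullKern, if_pos hi]; exact kern_le hq
  · obtain ⟨C, M, hC, hM, h⟩ := kern_le (x := a * q) (s := σ i) (t := τ i) hq
    refine ⟨C, M, hC, hM, fun n j hj => ?_⟩
    rw [fullKern, if_neg hi, norm_mul]
    refine (mul_le_of_le_one_left (norm_nonneg _) ?_).trans (h n j hj)
    split_ifs
    · exact norm_qpow_le hq n
    · simp

theorem chainProd_le {K : ℕ → ℕ → ℕ → ℂ}
    (h : ∀ i, ∃ C M : ℝ, 0 ≤ C ∧ 1 ≤ M ∧ ∀ n, ∀ j ≤ n, ‖K i n j‖ ≤ C * M ^ n) (m : ℕ) :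
    ∃ C M : ℝ, 0 ≤ C ∧ 1 ≤ M ∧ ∀ s : Chain m, ‖chainProd K s‖ ≤ C * M ^ s.entry 1 := by
  choose C M hC hM h using h
  refine ⟨∏ i ∈ range m, C i, ∏ i ∈ range m, M i, prod_nonneg fun i _ => hC i,
    by
      simpa using prod_le_prod (s := range m) (fun _ _ => zero_le_one) fun i _ => hM i, fun s => ?_⟩
  rw [chainProd, norm_prod, ← prod_pow, ← prod_mul_distrib]
  refine prod_le_prod (fun _ _ => norm_nonneg _) fun i _ => ?_
  refine (h i _ _ (s.antitone_entry (Nat.le_succ i))).trans ?_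
  have := hC i
  have := hM i
  gcongr
  · exact s.antitone_entry (Nat.zero_le i)

/-- The product of kernels grows at most exponentially in `s_1`, so a weight decaying faster than
every exponential leaves any prescribed rate `ρ`. -/
theorem weighted_chainProd_le {W : ℕ → ℂ} (hW : SuperDecay W) {K : ℕ → ℕ → ℕ → ℂ}
    (h : ∀ i, ∃ C M : ℝ, 0 ≤ C ∧ 1 ≤ M ∧ ∀ n, ∀ j ≤ n, ‖K i n j‖ ≤ C * M ^ n) (m : ℕ)
    {ρ : ℝ} (hρ : 0 < ρ) :
    ∃ C : ℝ, ∀ s : Chain m, ‖W (s.entry 1) * chainProd K s‖ ≤ C * ρ ^ s.entry 1 := by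
  obtain ⟨C, M, hC, hM, hK⟩ := chainProd_le h m
  obtain ⟨D, hD, h⟩ := hW (ρ / M) (by positivity)
  refine ⟨D * C, fun s => ?_⟩
  rw [norm_mul]
  calc _ ≤ (D * (ρ / M) ^ s.entry 1) * (C * M ^ s.entry 1) := by
        gcongr <;> [exact h _; exact hK s]
    _ = D * C * (ρ / M * M) ^ s.entry 1 := by rw [mul_pow]; ring
    _ = _ := by rw [div_mul_cancel₀ _ (by positivity)]

theorem expBdd_mult {q x s t : ℂ} (hq : ‖q‖ < 1) : ExpBdd (mult q x s t) := by
  have := (((expBdd_br hq 1 s).mul (expBdd_br hq 1 t)).mul (.pow x)).mul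
    ((expBdd_qPoch_inv (x := x * s) hq).mul (expBdd_qPoch_inv (x := x * t) hq))
  convert this using 2 with n
  rw [mult, div_eq_mul_inv, mul_inv]

theorem superDecay_mult_zero {q x s : ℂ} (hq : ‖q‖ < 1) : SuperDecay (mult q x s 0) := by
  have := (superDecay_br hq).mul_expBdd (((expBdd_br hq 1 s).mul (.pow x)).mul
    (expBdd_qPoch_inv (x := x * s) hq))
  convert this using 2 with n
  rw [mult, mul_zero, qPoch_zero_right]
  ring

theorem expBdd_changeSeq {q a : ℂ} (hq : ‖q‖ < 1) (R S : ℕ) (σ τ : ℕ → ℂ) :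
    ExpBdd (changeSeq q a R S σ τ) := by
  have := (ExpBdd.pow q).mul ((((expBdd_qPoch hq a).mul (expBdd_br hq 1 0)).mul
    (expBdd_qPoch_inv (x := q) hq)).mul
    (.finset_prod (range S) fun i _ => expBdd_mult (x := a * q) (s := σ (R + i)) (t := τ (R + i)) hq))
  exact this

/-- The weight of the outermost summation index. -/
def headWeight (q a s : ℂ) (n : ℕ) : ℂ := br q 1 s n * br q 1 0 n * a ^ n

theorem superDecay_headWeight {q a s : ℂ} (hq : ‖q‖ < 1) : SuperDecay (headWeight q a s) := by
  have := (superDecay_br hq).mul_expBdd ((expBdd_br hq 1 s).mul (.pow a))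
  convert this using 2 with n
  rw [headWeight]
  ring

/-- The factor of `α` that comes from the kernels relative to `a / q`. -/
def outerSeq (q a s : ℂ) (R : ℕ) (σ τ : ℕ → ℂ) (j : ℕ) : ℂ :=
  mult q a s 0 j * ∏ i ∈ range R, mult q a (σ i) (τ i) j

theorem superDecay_outerSeq {q a s : ℂ} (hq : ‖q‖ < 1) (R : ℕ) (σ τ : ℕ → ℂ) :
    SuperDecay (outerSeq q a s R σ τ) :=
  (superDecay_mult_zero hq).mul_expBdd (.finset_prod _ fun _ _ => expBdd_mult hq)

theorem SuperDecay.shift {f : ℕ → ℂ} (h : SuperDecay f) : SuperDecay (fun n => f (n + 1)) := by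
  intro ρ hρ
  obtain ⟨C, hC, h⟩ := h ρ hρ
  exact ⟨C * ρ, by positivity, fun n => (h _).trans_eq (by ring)⟩

theorem summable_single {q a s : ℂ} (hq : ‖q‖ < 1) (R S : ℕ) (σ τ : ℕ → ℂ) :
    Summable fun j => (outerSeq q a s R σ τ j - outerSeq q a s R σ τ (j + 1))
      * changeSeq q a R S σ τ j := by
  have hG := expBdd_changeSeq (a := a) hq R S σ τ
  have hF := superDecay_outerSeq (a := a) (s := s) hq R σ τ
  simpa only [sub_mul] using (hF.mul_expBdd hG).summable.sub (hF.shift.mul_expBdd hG).summable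

theorem summable_chain {q a s : ℂ} (hq : ‖q‖ < 1) (m R : ℕ) (σ τ : ℕ → ℂ) :
    Summable fun c : Chain m => headWeight q a s (c.entry 1) * chainProd (fullKern q a R σ τ) c := by
  obtain ⟨C, h⟩ := weighted_chainProd_le (superDecay_headWeight (a := a) (s := s) hq)
    (fullKern_le (a := a) hq R σ τ) m (ρ := (1 / 2) ^ m) (by positivity)
  exact summable_chain_of_le h

/-- This is the identity for arbitrary kernel parameters. The limiting Bailey lemma gives `∑ F_j
(G_j - G_{j-1})`, and shifting the index in the second half gives the stated difference form; the
decay of `F` makes both halves summable. -/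
theorem tsum_chain_eq {q a s : ℂ} {R S : ℕ} {σ τ : ℕ → ℂ} (hq : ‖q‖ < 1)
    (ha : ∀ n : ℕ, a * q ^ n ≠ 1) (hs : ∀ n : ℕ, a * s * q ^ n ≠ 1)
    (h1 : ∀ i < R, ∀ n : ℕ, a * σ i * q ^ n ≠ 1) (h2 : ∀ i < R, ∀ n : ℕ, a * τ i * q ^ n ≠ 1)
    (h3 : ∀ i < S, ∀ n : ℕ, a * q * σ (R + i) * q ^ n ≠ 1)
    (h4 : ∀ i < S, ∀ n : ℕ, a * q * τ (R + i) * q ^ n ≠ 1) :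
    ∑' c : Chain (S + R), headWeight q a s (c.entry 1) * chainProd (fullKern q a R σ τ) c
      = qPochInf q (a * s) / qPochInf q a * ∑' j,
        (outerSeq q a s R σ τ j - outerSeq q a s R σ τ (j + 1)) * changeSeq q a R S σ τ j := by
  have hb := isBailey_fullKern hq ha h1 h2 h3 h4
  have hsum := hasSum_head (summable_chain (a := a) (s := s) hq (S + R) R σ τ)
  have hG := expBdd_changeSeq (a := a) hq R S σ τ
  have hF := superDecay_outerSeq (a := a) (s := s) hq R σ τ
  set F := outerSeq q a s R σ τ with hFd
  set G := changeSeq q a R S σ τ with hGd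
  have s1 := (hF.mul_expBdd hG).summable
  have s2 := (hF.shift.mul_expBdd hG).summable
  have s3 : Summable fun j => if j = 0 then 0 else F j * G (j - 1) := by
    rw [← summable_nat_add_iff 1]
    simpa using s2
  have e : ∀ j, (G j - if j = 0 then 0 else G (j - 1)) * (∏ i ∈ range R, mult q a (σ i) (τ i) j)
      * mult q a s 0 j = F j * G j - if j = 0 then 0 else F j * G (j - 1) := by
    intro j
    simp only [hFd, outerSeq]
    split_ifs <;> ring
  rw [← hsum.tsum_eq]
  have := hb.tsum_eq hq ha hs hsum.summable (by simpa only [e] using s1.sub s3)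
  simp only [headWeight]
  rw [this]
  congr 1
  rw [tsum_congr e]
  simp only [sub_mul]
  rw [s1.tsum_sub s3, s1.tsum_sub s2, s3.tsum_eq_zero_add]
  simp

/-! ### Specialization of the parameters -/

theorem br_inv {q c : ℂ} (hc : c ≠ 0) (n : ℕ) : br q 1 c⁻¹ n = qPoch q c n * (c ^ n)⁻¹ := by
  induction n with
  | zero => simp [br_zero, qPoch_zero]
  | succ n ih => rw [br_succ, qPoch_succ, ih, pow_succ c]; field_simp

theorem br_one_zero (q : ℂ) (n : ℕ) : br q 1 0 n = (-1) ^ n * q ^ n.choose 2 := by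
  induction n with
  | zero => simp [br_zero]
  | succ n ih =>
    rw [br_succ, ih, Nat.choose_succ_succ' n 1, Nat.choose_one_right, pow_succ, pow_add]
    ring

theorem br_one_zero_mul_self (q : ℂ) (n : ℕ) : br q 1 0 n * br q 1 0 n = q ^ (n * (n - 1)) := by
  rw [br_one_zero, Nat.choose_two_right, mul_mul_mul_comm, ← mul_pow, ← pow_add]
  rw [← two_mul, Nat.mul_div_cancel' (Nat.even_mul_pred_self n).two_dvd]
  simp

theorem br_one_zero_sq_mul (q : ℂ) (n : ℕ) :
    br q 1 0 n * br q 1 0 n * q ^ n = q ^ n ^ 2 := by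
  rw [br_one_zero_mul_self, ← pow_add]
  congr 1
  cases n with
  | zero => rfl
  | succ n => rw [Nat.add_sub_cancel]; ring

theorem kern_zero_zero (q a : ℂ) (n j : ℕ) :
    kern q (a * q) 0 0 n j = a ^ j * q ^ j ^ 2 / qPoch q q (n - j) := by
  rw [kern, ← br_one_zero_sq_mul, mul_pow]
  simp only [mul_zero, qPoch_zero_right, mul_one]
  ring

theorem mult_zero_zero (q a : ℂ) (j : ℕ) : mult q (a * q) 0 0 j = a ^ j * q ^ j ^ 2 := by
  rw [mult, ← br_one_zero_sq_mul, mul_pow]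
  simp only [mul_zero, qPoch_zero_right, mul_one]
  ring

/-- The values `1 / ρ₁` for the successive kernels. -/
def sigmaSeq (b : ℕ → ℂ) (R S : ℕ) (u : ℂ) (i : ℕ) : ℂ :=
  if i < R then (b (i + 2))⁻¹ else if i + 1 = S + R then u else 0

/-- The values `1 / ρ₂` for the successive kernels. -/
def tauSeq (b : ℕ → ℂ) (R S : ℕ) (v : ℂ) (i : ℕ) : ℂ :=
  if i < R then (b (2 * (R + 1) + 1 - (i + 2)))⁻¹ else if i + 1 = S + R then v else 0

theorem prod_Icc_two {M : Type*} [CommMonoid M] (f : ℕ → M) (R : ℕ) :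
    ∏ i ∈ Icc 2 (R + 1), f i = ∏ i ∈ range R, f (i + 2) := by
  rw [← Ico_add_one_right_eq_Icc, prod_Ico_eq_prod_range, show R + 1 + 1 - 2 = R by omega]
  simp [add_comm]

theorem prod_Icc_one {M : Type*} [CommMonoid M] (f : ℕ → M) (R : ℕ) :
    ∏ i ∈ Icc 1 R, f i = ∏ i ∈ range R, f (i + 1) := by
  rw [← Ico_add_one_right_eq_Icc, prod_Ico_eq_prod_range]
  simp [add_comm]

/-- Reversing the upper half of the indices `2, …, 2r - 1` matches `b_i` with `b_{2r+1-i}`, leaving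
`b_1` alone. -/
theorem prod_Icc_pairs {M : Type*} [CommMonoid M] (f : ℕ → M) (R : ℕ) :
    ∏ i ∈ Icc 1 (2 * (R + 1) - 1), f i
      = f 1 * ∏ i ∈ range R, (f (i + 2) * f (2 * (R + 1) + 1 - (i + 2))) := by
  rw [prod_Icc_one, show 2 * (R + 1) - 1 = R + R + 1 by omega, prod_range_succ', mul_comm,
    prod_range_add, prod_mul_distrib, ← prod_range_reflect (fun i => f (R + i + 1 + 1))]
  congr 2
  refine prod_congr rfl fun i hi => ?_
  have := mem_range.1 hi
  congr 1
  omega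

theorem chainProd_fullKern (q a u v : ℂ) (b : ℕ → ℂ) (R S : ℕ) (s : Chain (S + R)) :
    chainProd (fullKern q a R (sigmaSeq b R S u) (tauSeq b R S v)) s
      = (∏ i ∈ range R, kern q a (b (i + 2))⁻¹ (b (2 * (R + 1) + 1 - (i + 2)))⁻¹
          (s.entry (i + 1)) (s.entry (i + 2)))
        * (q ^ s.entry (R + 1) * ∏ i ∈ range S, kern q (a * q)
            (if i + 1 = S then u else 0) (if i + 1 = S then v else 0)
            (s.entry (R + i + 1)) (s.entry (R + i + 2))) := by
  rw [chainProd, show range (S + R) = range (R + S) by rw [add_comm], prod_range_add]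
  congr 1
  · refine prod_congr rfl fun i hi => ?_
    have := mem_range.1 hi
    rw [fullKern, sigmaSeq, tauSeq, if_pos this, if_pos this, if_pos this]
  -- For `S = 0` no kernel is left to carry this power, but then `s_{R+1}` lies beyond the chain and
  -- is `0`.
  · have : q ^ s.entry (R + 1)
        = ∏ i ∈ range S, if R + i = R then q ^ s.entry (R + i + 1) else 1 := by
      cases S with
      | zero => rw [s.entry_of_lt (by omega)]; simp
      | succ S => rw [prod_range_succ']; simp
    rw [this, ← prod_mul_distrib]
    refine prod_congr rfl fun i _ => ?_
    have h : R + i + 1 = S + R ↔ i + 1 = S := by omega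
    have h' : ¬R + i < R := by omega
    simp only [fullKern, sigmaSeq, tauSeq, h, h', if_false]

/-- The last difference is `s_m - 0`, which accounts for the separate factor `(q)_{s_m}`. The
hypothesis on `E 0` serves the empty chain. -/
theorem prod_qPoch_sub {q : ℂ} {m : ℕ} {E : ℕ → ℕ} (h0 : E 0 = 0) (hm : E (m + 1) = 0) :
    qPoch q q (E m) * ∏ i ∈ range (m - 1), qPoch q q (E (i + 1) - E (i + 2))
      = ∏ i ∈ range m, qPoch q q (E (i + 1) - E (i + 2)) := by
  cases m with
  | zero => simp [h0, qPoch_zero]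
  | succ m => rw [prod_range_succ, hm, Nat.sub_zero, mul_comm, Nat.add_sub_cancel]

theorem lhsCore_eq (q a : ℂ) (b : ℕ → ℂ) (R S : ℕ)
    (hb : ∀ i ∈ Icc 1 (2 * (R + 1) - 1), b i ≠ 0) (s : Chain (S + R)) :
    lhsCore q a b (S + R + 1) (R + 1) s = headWeight q a (b 1)⁻¹ (s.entry 1)
      * chainProd (fullKern q a R (sigmaSeq b R S 0) (tauSeq b R S 0)) s := by
  have hm : ∀ i, S + R < i → s.entry i = 0 := fun i => s.entry_of_lt
  have h0 : s.entry 0 = 0 := by rw [Chain.entry, dif_neg (by omega)]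
  have hb1 : b 1 ≠ 0 := hb 1 (by simp; omega)
  have hb2 : ∀ i ∈ range R, b (i + 2) ≠ 0 := fun i hi => hb _ (by
    have := mem_range.1 hi
    simp; omega)
  have hb3 : ∀ i ∈ range R, b (2 * (R + 1) + 1 - (i + 2)) ≠ 0 := fun i hi => hb _ (by
    have := mem_range.1 hi
    simp; omega)
  rw [lhsCore, chainProd_fullKern, headWeight, br_one_zero, br_inv hb1]
  generalize hE : @Chain.entry (S + R) s = E at *
  have e1 : a ^ (∑ i ∈ Icc 1 (S + R), E i) = a ^ E 1
      * ((∏ i ∈ range R, a ^ E (i + 2)) * ∏ i ∈ range S, a ^ E (R + i + 2)) := by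
    rw [← prod_range_add (fun i => a ^ E (i + 2)), mul_comm,
      ← prod_range_succ' (fun i => a ^ E (i + 1)), prod_range_succ, hm _ (by omega), pow_zero,
      mul_one, prod_pow_eq_pow_sum, add_comm R S]
    congr 1
    exact Multiplicative.ofAdd.injective (prod_Icc_one (fun i => Multiplicative.ofAdd (E i)) _)
  have e2 : q ^ (∑ i ∈ Icc (R + 1 + 1) (S + R), E i ^ 2)
      = ∏ i ∈ range S, q ^ E (R + i + 2) ^ 2 := by
    rw [← prod_pow_eq_pow_sum]
    cases S with
    | zero => simp
    | succ S =>
      rw [prod_range_succ, hm (R + S + 2) (by omega), ← Ico_add_one_right_eq_Icc,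
        prod_Ico_eq_prod_range, show S + 1 + R + 1 - (R + 1 + 1) = S by omega]
      simp only [ne_eq, OfNat.ofNat_ne_zero, not_false_eq_true, zero_pow, pow_zero, mul_one]
      refine prod_congr rfl fun i _ => ?_
      rw [show R + 1 + 1 + i = R + i + 2 by omega]
  have e3 : qPoch q q (E (S + R)) * (∏ i ∈ Icc 1 (S + R + 1 - 2), qPoch q q (E i - E (i + 1)))
      = (∏ i ∈ range R, qPoch q q (E (i + 1) - E (i + 2)))
        * ∏ i ∈ range S, qPoch q q (E (R + i + 1) - E (R + i + 2)) := by
    rw [← prod_range_add (fun i => qPoch q q (E (i + 1) - E (i + 2))), add_comm R S,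
      prod_Icc_one, ← prod_qPoch_sub h0 (hm _ (Nat.lt_succ_self _))]
    rfl
  have key : ∀ A B X C Y D : ℂ, A * B * (1 / X) * C / Y * D = A * B * C * D * (X * Y)⁻¹ := by
    intro A B X C Y D
    simp only [div_eq_mul_inv, mul_inv]
    ring
  rw [key, Nat.add_sub_cancel, e3, pow_add q, pow_add q, e1, e2]
  simp only [ite_self, kern_zero_zero]
  have e4 : ∀ i ∈ range R,
      kern q a (b (i + 2))⁻¹ (b (2 * (R + 1) + 1 - (i + 2)))⁻¹ (E (i + 1)) (E (i + 2))
      = (qPoch q (b (i + 2)) (E (i + 2))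
          * qPoch q (b (2 * (R + 1) + 1 - (i + 2))) (E (i + 2)))
        * ((b (i + 2) * b (2 * (R + 1) + 1 - (i + 2))) ^ E (i + 2))⁻¹
        * a ^ E (i + 2)
        * qPoch q (a / (b (i + 2) * b (2 * (R + 1) + 1 - (i + 2)))) (E (i + 1) - E (i + 2))
        * (qPoch q q (E (i + 1) - E (i + 2)))⁻¹
        * (qPoch q (a / b (i + 2)) (E (i + 1))
          * qPoch q (a / b (2 * (R + 1) + 1 - (i + 2))) (E (i + 1)))⁻¹ := by
    intro i hi
    rw [kern, br_inv (hb2 i hi), br_inv (hb3 i hi), div_mul_eq_div_div, mul_pow]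
    simp only [div_eq_mul_inv, mul_inv]
    ring_nf
  rw [prod_congr rfl e4]
  simp only [prod_Icc_two, prod_mul_distrib, prod_div_distrib, prod_inv_distrib, mul_pow,
    show ∀ i, i + 2 - 1 = i + 1 from fun _ => rfl]
  simp only [div_eq_mul_inv, mul_inv]
  ring

/-- Only the innermost kernel contains `c₁, c₂`, and its second index is `s_k = 0`. There the
numerator factors `(c₁)_j, (c₂)_j` are `1`, and what remains is the ratio in `s_{k-1}`. -/
theorem lhsTerm_eq (q a c₁ c₂ : ℂ) (b : ℕ → ℂ) (R S : ℕ)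
    (hb : ∀ i ∈ Icc 1 (2 * (R + 1) - 1), b i ≠ 0) (s : Chain (S + 1 + R)) :
    lhsTerm q a c₁ c₂ b (S + 1 + R + 1) (R + 1) s = headWeight q a (b 1)⁻¹ (s.entry 1)
      * chainProd (fullKern q a R (sigmaSeq b R (S + 1) c₁⁻¹) (tauSeq b R (S + 1) c₂⁻¹)) s := by
  have hm : s.entry (R + S + 2) = 0 := s.entry_of_lt (by omega)
  rw [lhsTerm, lhsCore_eq q a b R (S + 1) hb, chainProd_fullKern, chainProd_fullKern]
  generalize hE : @Chain.entry (S + 1 + R) s = E at *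
  rw [prod_range_succ, prod_range_succ]
  have e : ∀ w : ℂ, ∀ i ∈ range S, (if i + 1 = S + 1 then w else 0) = 0 := fun w i hi => by
    have := mem_range.1 hi
    rw [if_neg (by omega)]
  have e' : ∀ u v : ℂ, ∏ i ∈ range S, kern q (a * q) (if i + 1 = S + 1 then u else 0)
      (if i + 1 = S + 1 then v else 0) (E (R + i + 1)) (E (R + i + 2))
      = ∏ i ∈ range S, kern q (a * q) 0 0 (E (R + i + 1)) (E (R + i + 2)) :=
    fun u v => prod_congr rfl fun i hi => by rw [e u i hi, e v i hi]
  rw [e', e', hm, show S + 1 + R + 1 - 1 = R + S + 1 by omega]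
  simp only [if_true, kern, br_zero, Nat.sub_zero, pow_zero, mul_zero, qPoch_zero_right, mul_inv,
    div_eq_mul_inv, mul_one, one_mul, ← mul_assoc]
  ring

theorem outerSeq_eq (q a : ℂ) (b : ℕ → ℂ) (R S : ℕ) (u v : ℂ)
    (hb : ∀ i ∈ Icc 1 (2 * (R + 1) - 1), b i ≠ 0) (j : ℕ) :
    outerSeq q a (b 1)⁻¹ R (sigmaSeq b R S u) (tauSeq b R S v) j
      = (∏ i ∈ Icc 1 (2 * (R + 1) - 1), qPoch q (b i) j)
        * ((∏ i ∈ Icc 1 (2 * (R + 1) - 1), b i) ^ j)⁻¹ * a ^ ((R + 1) * j)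
        * (∏ i ∈ Icc 1 (2 * (R + 1) - 1), qPoch q (a / b i) j)⁻¹ * br q 1 0 j := by
  have hb1 : b 1 ≠ 0 := hb 1 (by simp; omega)
  have e : ∀ i ∈ range R, mult q a (sigmaSeq b R S u i) (tauSeq b R S v i) j
      = (qPoch q (b (i + 2)) j * qPoch q (b (2 * (R + 1) + 1 - (i + 2))) j)
        * ((b (i + 2) * b (2 * (R + 1) + 1 - (i + 2))) ^ j)⁻¹
        * (qPoch q (a / b (i + 2)) j * qPoch q (a / b (2 * (R + 1) + 1 - (i + 2))) j)⁻¹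
        * a ^ j := by
    intro i hi
    have := mem_range.1 hi
    rw [sigmaSeq, tauSeq, if_pos this, if_pos this, mult, br_inv (hb _ (by simp; omega)),
      br_inv (hb _ (by simp; omega)), mul_pow]
    simp only [div_eq_mul_inv, mul_inv]
    ring
  rw [outerSeq, prod_congr rfl e, mult, br_inv hb1]
  simp only [prod_Icc_pairs, mul_zero, qPoch_zero_right]
  rw [prod_mul_distrib, prod_mul_distrib, prod_mul_distrib, prod_inv_distrib, prod_inv_distrib,
    prod_pow, prod_const, card_range, mul_pow, add_mul, pow_add, ← pow_mul, mul_comm j R,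
    div_eq_mul_inv a]
  simp only [div_eq_mul_inv, mul_inv]
  ring

/-- Each product acquires one factor when `j` becomes `j + 1`; the factor `-q^j` of `br q 1 0` turns
the difference into `1 + ⋯`. -/
theorem outerSeq_sub (q a : ℂ) (b : ℕ → ℂ) (R S : ℕ) (u v : ℂ)
    (hb : ∀ i ∈ Icc 1 (2 * (R + 1) - 1), b i ≠ 0) (j : ℕ) :
    outerSeq q a (b 1)⁻¹ R (sigmaSeq b R S u) (tauSeq b R S v) j
      - outerSeq q a (b 1)⁻¹ R (sigmaSeq b R S u) (tauSeq b R S v) (j + 1)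
      = outerSeq q a (b 1)⁻¹ R (sigmaSeq b R S u) (tauSeq b R S v) j
        * (1 + a ^ (R + 1) * q ^ j / (∏ i ∈ Icc 1 (2 * (R + 1) - 1), b i)
        * ((∏ i ∈ Icc 1 (2 * (R + 1) - 1), (1 - b i * q ^ j))
          / ∏ i ∈ Icc 1 (2 * (R + 1) - 1), (1 - a * q ^ j / b i))) := by
  rw [outerSeq_eq q a b R S u v hb, outerSeq_eq q a b R S u v hb, br_succ]
  simp only [qPoch_succ, prod_mul_distrib, mul_add, pow_succ, pow_add, div_mul_eq_mul_div, mul_one]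
  simp only [div_eq_mul_inv, mul_inv]
  ring

theorem changeSeq_zero (q a : ℂ) (b : ℕ → ℂ) (R S j : ℕ) :
    changeSeq q a R S (sigmaSeq b R S 0) (tauSeq b R S 0) j
      = q ^ j * qPoch q a j * br q 1 0 j * (qPoch q q j)⁻¹ * a ^ (S * j) * q ^ (S * j ^ 2) := by
  have e : ∀ i ∈ range S, mult q (a * q) (sigmaSeq b R S 0 (R + i)) (tauSeq b R S 0 (R + i)) j
      = a ^ j * q ^ j ^ 2 := fun i _ => by
    simp [sigmaSeq, tauSeq, mult_zero_zero]
  rw [changeSeq, prod_congr rfl e, prod_const, card_range, mul_pow, ← pow_mul, ← pow_mul,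
    mul_comm j S, mul_comm (j ^ 2) S]
  ring

theorem changeSeq_inv (q a : ℂ) {c₁ c₂ : ℂ} (h₁ : c₁ ≠ 0) (h₂ : c₂ ≠ 0) (b : ℕ → ℂ) (R S j : ℕ) :
    changeSeq q a R (S + 1) (sigmaSeq b R (S + 1) c₁⁻¹) (tauSeq b R (S + 1) c₂⁻¹) j
      = q ^ j * qPoch q a j * br q 1 0 j * (qPoch q q j)⁻¹ * a ^ ((S + 1) * j) * q ^ (S * j ^ 2 + j)
        * (qPoch q c₁ j * qPoch q c₂ j * ((c₁ * c₂) ^ j)⁻¹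
        / (qPoch q (a * q / c₁) j * qPoch q (a * q / c₂) j)) := by
  have e : ∀ i ∈ range S, mult q (a * q) (sigmaSeq b R (S + 1) c₁⁻¹ (R + i))
      (tauSeq b R (S + 1) c₂⁻¹ (R + i)) j = a ^ j * q ^ j ^ 2 := fun i hi => by
    have := mem_range.1 hi
    have hne : ¬R + i + 1 = S + 1 + R := by omega
    simp [sigmaSeq, tauSeq, mult_zero_zero, hne]
  have h1 : sigmaSeq b R (S + 1) c₁⁻¹ (R + S) = c₁⁻¹ := by
    rw [sigmaSeq, if_neg (by omega), if_pos (by omega)]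
  have h2 : tauSeq b R (S + 1) c₂⁻¹ (R + S) = c₂⁻¹ := by
    rw [tauSeq, if_neg (by omega), if_pos (by omega)]
  rw [changeSeq, prod_range_succ, prod_congr rfl e, prod_const, card_range, mul_pow, ← pow_mul,
    ← pow_mul, mul_comm j S, mul_comm (j ^ 2) S, h1, h2, mult, br_inv h₁, br_inv h₂, mul_pow,
    mul_pow, add_mul, pow_add, pow_add, one_mul]
  simp only [div_eq_mul_inv, mul_inv]
  ring

theorem rhsTermLim_eq (q a : ℂ) (b : ℕ → ℂ) (R S : ℕ)
    (hb : ∀ i ∈ Icc 1 (2 * (R + 1) - 1), b i ≠ 0) (j : ℕ) :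
    rhsTermLim q a b (S + R + 1) (R + 1) j
      = (outerSeq q a (b 1)⁻¹ R (sigmaSeq b R S 0) (tauSeq b R S 0) j
        - outerSeq q a (b 1)⁻¹ R (sigmaSeq b R S 0) (tauSeq b R S 0) (j + 1))
        * changeSeq q a R S (sigmaSeq b R S 0) (tauSeq b R S 0) j := by
  rw [outerSeq_sub q a b R S 0 0 hb, outerSeq_eq q a b R S 0 0 hb, changeSeq_zero, rhsTermLim,
    rhsCore, show S + R + 1 - (R + 1) = S by omega, pow_add, pow_add, ← br_one_zero_mul_self,
    add_assoc S, add_mul S, pow_add a]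
  simp only [div_eq_mul_inv, mul_inv]
  ring

theorem rhsTerm_eq (q a : ℂ) {c₁ c₂ : ℂ} (h₁ : c₁ ≠ 0) (h₂ : c₂ ≠ 0) (b : ℕ → ℂ) (R S : ℕ)
    (hb : ∀ i ∈ Icc 1 (2 * (R + 1) - 1), b i ≠ 0) (j : ℕ) :
    rhsTerm q a c₁ c₂ b (S + 1 + R + 1) (R + 1) j
      = (outerSeq q a (b 1)⁻¹ R (sigmaSeq b R (S + 1) c₁⁻¹) (tauSeq b R (S + 1) c₂⁻¹) j
        - outerSeq q a (b 1)⁻¹ R (sigmaSeq b R (S + 1) c₁⁻¹) (tauSeq b R (S + 1) c₂⁻¹) (j + 1))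
        * changeSeq q a R (S + 1) (sigmaSeq b R (S + 1) c₁⁻¹) (tauSeq b R (S + 1) c₂⁻¹) j := by
  rw [outerSeq_sub q a b R _ _ _ hb, outerSeq_eq q a b R _ _ _ hb, changeSeq_inv q a h₁ h₂, rhsTerm,
    rhsCore, show S + 1 + R + 1 - (R + 1) = S + 1 by omega, add_mul S 1 (j ^ 2), one_mul, pow_add,
    pow_add, pow_add, ← br_one_zero_sq_mul, add_assoc (S + 1), add_mul (S + 1), pow_add a]
  simp only [div_eq_mul_inv, mul_inv]
  ring

/-! ### The identities for finite and infinite `c₁, c₂` -/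

theorem lhsCore_le {q a : ℂ} {b : ℕ → ℂ} {r k : ℕ} (hq : ‖q‖ < 1) (hr : 0 < r) (hk : r ≤ k)
    (hb : ∀ i ∈ Icc 1 (2 * r - 1), b i ≠ 0) {ρ : ℝ} (hρ : 0 < ρ) :
    ∃ C : ℝ, ∀ s : Chain (k - 1), ‖lhsCore q a b k r s‖ ≤ C * ρ ^ s.entry 1 := by
  obtain ⟨R, rfl⟩ : ∃ R, r = R + 1 := ⟨r - 1, by omega⟩
  obtain ⟨S, rfl⟩ : ∃ S, k = S + R + 1 := ⟨k - (R + 1), by omega⟩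
  obtain ⟨C, h⟩ := weighted_chainProd_le (superDecay_headWeight (a := a) (s := (b 1)⁻¹) hq)
    (fullKern_le (a := a) hq R (sigmaSeq b R S 0) (tauSeq b R S 0)) (S + R) hρ
  exact ⟨C, fun s => by rw [lhsCore_eq q a b R S hb s]; exact h s⟩

theorem mul_inv_mul_ne_one {x y z : ℂ} (hy : y ≠ 0) (h : x * z ≠ y) : x * y⁻¹ * z ≠ 1 := by
  intro e
  refine h ?_
  field_simp at e
  exact e

theorem identity_finite {q a : ℂ} {b : ℕ → ℂ} {r k : ℕ} (hq : ‖q‖ < 1)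
    (ha : ∀ n : ℕ, a * q ^ n ≠ 1) (hr : 0 < r) (hk : r < k)
    (hb : ∀ i ∈ Icc 1 (2 * r - 1), b i ≠ 0 ∧ ∀ n : ℕ, a * q ^ n ≠ b i) {c₁ c₂ : ℂ} (h₁ : c₁ ≠ 0)
    (h₂ : c₂ ≠ 0) (hc₁ : ∀ n : ℕ, a * q ^ (n + 1) ≠ c₁) (hc₂ : ∀ n : ℕ, a * q ^ (n + 1) ≠ c₂) :
    Summable (lhsTerm q a c₁ c₂ b k r) ∧ Summable (rhsTerm q a c₁ c₂ b k r) ∧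
      lhs q a c₁ c₂ b k r = rhs q a c₁ c₂ b k r := by
  obtain ⟨R, rfl⟩ : ∃ R, r = R + 1 := ⟨r - 1, by omega⟩
  obtain ⟨S, rfl⟩ : ∃ S, k = S + 1 + R + 1 := ⟨k - (R + 2), by omega⟩
  have hb0 : ∀ i ∈ Icc 1 (2 * (R + 1) - 1), b i ≠ 0 := fun i hi => (hb i hi).1
  have hb' : ∀ i ∈ Icc 1 (2 * (R + 1) - 1), ∀ n : ℕ, a * (b i)⁻¹ * q ^ n ≠ 1 := fun i hi n =>
    mul_inv_mul_ne_one (hb i hi).1 ((hb i hi).2 n)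
  have hc : ∀ c : ℂ, c ≠ 0 → (∀ n : ℕ, a * q ^ (n + 1) ≠ c) → ∀ n : ℕ, a * q * c⁻¹ * q ^ n ≠ 1 :=
    fun c h0 h n => mul_inv_mul_ne_one h0 (by rw [mul_assoc, ← pow_succ']; exact h n)
  have eL : lhsTerm q a c₁ c₂ b (S + 1 + R + 1) (R + 1) = _ := funext (lhsTerm_eq q a c₁ c₂ b R S hb0)
  have eR := funext (rhsTerm_eq q a h₁ h₂ b R S hb0)
  rw [lhs, rhs, eL, eR]
  refine ⟨summable_chain hq _ R _ _, summable_single hq R (S + 1) _ _, ?_⟩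
  rw [div_eq_mul_inv a]
  refine tsum_chain_eq hq ha (hb' 1 (by simp; omega)) (fun i hi => ?_) (fun i hi => ?_)
    (fun i hi n => ?_) (fun i hi n => ?_)
  · rw [sigmaSeq, if_pos hi]; exact hb' _ (by simp; omega)
  · rw [tauSeq, if_pos hi]; exact hb' _ (by simp; omega)
  · rw [sigmaSeq, if_neg (by omega)]
    split_ifs
    · exact hc _ h₁ hc₁ n
    · simp
  · rw [tauSeq, if_neg (by omega)]
    split_ifs
    · exact hc _ h₂ hc₂ n
    · simp

/-- Setting `1/c₁ = 1/c₂ = 0` in the general identity proves this directly. This covers `r = k`,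
where no kernel relative to `a` occurs. -/
theorem identity_limit {q a : ℂ} {b : ℕ → ℂ} {r k : ℕ} (hq : ‖q‖ < 1)
    (ha : ∀ n : ℕ, a * q ^ n ≠ 1) (hr : 0 < r) (hk : r ≤ k)
    (hb : ∀ i ∈ Icc 1 (2 * r - 1), b i ≠ 0 ∧ ∀ n : ℕ, a * q ^ n ≠ b i) :
    Summable (lhsCore q a b k r) ∧ Summable (rhsTermLim q a b k r) ∧
      ∑' s : Chain (k - 1), lhsCore q a b k r s
        = qPochInf q (a / b 1) / qPochInf q a * ∑' j, rhsTermLim q a b k r j := by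
  obtain ⟨R, rfl⟩ : ∃ R, r = R + 1 := ⟨r - 1, by omega⟩
  obtain ⟨S, rfl⟩ : ∃ S, k = S + R + 1 := ⟨k - (R + 1), by omega⟩
  have hb0 : ∀ i ∈ Icc 1 (2 * (R + 1) - 1), b i ≠ 0 := fun i hi => (hb i hi).1
  have hb' : ∀ i ∈ Icc 1 (2 * (R + 1) - 1), ∀ n : ℕ, a * (b i)⁻¹ * q ^ n ≠ 1 := fun i hi n =>
    mul_inv_mul_ne_one (hb i hi).1 ((hb i hi).2 n)
  have eL : lhsCore q a b (S + R + 1) (R + 1) = _ := funext (lhsCore_eq q a b R S hb0)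
  have eR := funext (rhsTermLim_eq q a b R S hb0)
  rw [eL, eR]
  refine ⟨summable_chain hq _ R _ _, summable_single hq R S _ _, ?_⟩
  rw [div_eq_mul_inv a]
  refine tsum_chain_eq hq ha (hb' 1 (by simp; omega)) (fun i hi => ?_) (fun i hi => ?_)
    (fun i hi n => ?_) (fun i hi n => ?_)
  · rw [sigmaSeq, if_pos hi]; exact hb' _ (by simp; omega)
  · rw [tauSeq, if_pos hi]; exact hb' _ (by simp; omega)
  · rw [sigmaSeq, if_neg (by omega), ite_self]; simp
  · rw [tauSeq, if_neg (by omega), ite_self]; simp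

/-! ### The limits `c₁, c₂ → ∞` -/

theorem norm_qPoch_le {q x : ℂ} (hq : ‖q‖ < 1) (hx : ‖x‖ ≤ 1 / 2) (n : ℕ) :
    ‖qPoch q x n‖ ≤ 2 ^ n := by
  rw [qPoch, norm_prod, ← card_range n, ← prod_const, card_range]
  refine prod_le_prod (fun _ _ => norm_nonneg _) fun i _ => (norm_sub_le _ _).trans ?_
  rw [norm_one, norm_mul]
  have := norm_qpow_le hq i
  nlinarith [norm_nonneg x, norm_nonneg (q ^ i)]

theorem norm_qPoch_inv_le {q x : ℂ} (hq : ‖q‖ < 1) (hx : ‖x‖ ≤ 1 / 2) (n : ℕ) :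
    ‖(qPoch q x n)⁻¹‖ ≤ 2 ^ n := by
  rw [qPoch, ← prod_inv_distrib, norm_prod, ← card_range n, ← prod_const, card_range]
  refine prod_le_prod (fun _ _ => norm_nonneg _) fun i _ => ?_
  have h1 := norm_qpow_le hq i
  have h2 : ‖(1 : ℂ)‖ - ‖x * q ^ i‖ ≤ ‖1 - x * q ^ i‖ := norm_sub_norm_le _ _
  rw [norm_one, norm_mul] at h2
  rw [norm_inv]
  refine inv_le_of_inv_le₀ two_pos ?_
  nlinarith [norm_nonneg x, norm_nonneg (q ^ i)]

theorem tendsto_qPoch_of_tendsto {ι : Type*} {l : Filter ι} {f : ι → ℂ} {x : ℂ} (q : ℂ)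
    (h : Tendsto f l (𝓝 x)) (n : ℕ) : Tendsto (fun c => qPoch q (f c) n) l (𝓝 (qPoch q x n)) :=
  tendsto_finsetProd _ fun _ _ => (h.mul_const _).const_sub _

theorem tendsto_br_of_tendsto {ι : Type*} {l : Filter ι} {f : ι → ℂ} {x : ℂ} (q p : ℂ)
    (h : Tendsto f l (𝓝 x)) (n : ℕ) : Tendsto (fun c => br q p (f c) n) l (𝓝 (br q p x n)) :=
  tendsto_finsetProd _ fun _ _ => h.sub_const _

/-- Both parameters tend to infinity. -/
abbrev atInfinity : Filter (ℂ × ℂ) := Bornology.cobounded ℂ ×ˢ Bornology.cobounded ℂ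

theorem tendsto_inv_fst : Tendsto (fun c : ℂ × ℂ => c.1⁻¹) atInfinity (𝓝 0) :=
  tendsto_inv₀_cobounded.comp tendsto_fst

theorem tendsto_inv_snd : Tendsto (fun c : ℂ × ℂ => c.2⁻¹) atInfinity (𝓝 0) :=
  tendsto_inv₀_cobounded.comp tendsto_snd

theorem tendsto_div_fst (x : ℂ) : Tendsto (fun c : ℂ × ℂ => x / c.1) atInfinity (𝓝 0) := by
  simpa [div_eq_mul_inv] using tendsto_inv_fst.const_mul x

theorem tendsto_div_snd (x : ℂ) : Tendsto (fun c : ℂ × ℂ => x / c.2) atInfinity (𝓝 0) := by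
  simpa [div_eq_mul_inv] using tendsto_inv_snd.const_mul x

theorem tendsto_div_mul (x : ℂ) :
    Tendsto (fun c : ℂ × ℂ => x / (c.1 * c.2)) atInfinity (𝓝 0) := by
  have := (tendsto_div_fst x).mul tendsto_inv_snd
  simpa only [mul_zero, div_eq_mul_inv, mul_inv, mul_assoc] using this

theorem eventually_norm_le {f : ℂ × ℂ → ℂ} (h : Tendsto f atInfinity (𝓝 0)) {ε : ℝ} (hε : 0 < ε) :
    ∀ᶠ c in atInfinity, ‖f c‖ ≤ ε := by
  have := h.norm
  rw [norm_zero] at this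
  exact this.eventually_le_const hε

theorem Chain.entry_le {m : ℕ} (s : Chain m) (i : ℕ) : s.entry i ≤ s.entry 1 := by
  cases i with
  | zero => rw [Chain.entry, dif_neg (by omega)]; exact Nat.zero_le _
  | succ i => exact s.antitone_entry (Nat.zero_le i)

theorem lhs_limit {q a : ℂ} {b : ℕ → ℂ} {r k : ℕ} (hq : ‖q‖ < 1) (hr : 0 < r) (hk : r ≤ k)
    (hb : ∀ i ∈ Icc 1 (2 * r - 1), b i ≠ 0) :
    (∀ᶠ c in atInfinity, Summable (lhsTerm q a c.1 c.2 b k r)) ∧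
    Tendsto (fun c : ℂ × ℂ => lhs q a c.1 c.2 b k r) atInfinity
      (𝓝 (∑' s : Chain (k - 1), lhsCore q a b k r s)) := by
  -- The `8` pays for three `q`-factorials, each contributing at most `2^n` once its argument has
  -- modulus at most `1/2`; the power of `1/2` is the rate required by `summable_chain_of_le`.
  obtain ⟨C, hC⟩ := lhsCore_le (a := a) hq hr hk hb (ρ := (1 / 2) ^ (k - 1) / 8) (by positivity)
  have hbound : ∀ᶠ c in atInfinity, ∀ s : Chain (k - 1),
      ‖lhsTerm q a c.1 c.2 b k r s‖ ≤ C * ((1 / 2) ^ (k - 1)) ^ s.entry 1 := by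
    filter_upwards [eventually_norm_le (tendsto_div_fst (a * q)) (half_pos one_pos),
      eventually_norm_le (tendsto_div_snd (a * q)) (half_pos one_pos),
      eventually_norm_le (tendsto_div_mul (a * q)) (half_pos one_pos)] with c h1 h2 h3 s
    set n := s.entry (k - 1) with hn
    have hle : n ≤ s.entry 1 := s.entry_le _
    rw [lhsTerm, norm_mul, div_eq_mul_inv, mul_inv, norm_mul, norm_mul]
    have hCs := hC s
    have h8 : ‖qPoch q (a * q / (c.1 * c.2)) n‖ * (‖(qPoch q (a * q / c.1) n)⁻¹‖
        * ‖(qPoch q (a * q / c.2) n)⁻¹‖) ≤ 8 ^ s.entry 1 := by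
      calc _ ≤ (2 : ℝ) ^ n * (2 ^ n * 2 ^ n) := by
            gcongr
            · exact norm_qPoch_le hq h3 n
            · exact norm_qPoch_inv_le hq h1 n
            · exact norm_qPoch_inv_le hq h2 n
        _ = 8 ^ n := by rw [← mul_pow, ← mul_pow]; norm_num
        _ ≤ 8 ^ s.entry 1 := by gcongr; norm_num
    calc _ ≤ (C * ((1 / 2) ^ (k - 1) / 8) ^ s.entry 1) * 8 ^ s.entry 1 :=
          mul_le_mul hCs h8 (by positivity) ((norm_nonneg _).trans hCs)
      _ = _ := by rw [mul_assoc, ← mul_pow, div_mul_cancel₀ _ (by norm_num)]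
  refine ⟨hbound.mono fun c hc => summable_chain_of_le hc, ?_⟩
  have hC0 : 0 ≤ C := by
    by_contra h
    have := (norm_nonneg _).trans (hC (Chain.ofSeq _ 0 fun _ _ _ => le_rfl))
    exact absurd this (not_le.2 (mul_neg_of_neg_of_pos (not_le.1 h) (by positivity)))
  -- The real bound is viewed as a complex function so that `summable_chain_of_le` applies to it;
  -- its norm is the dominating function.
  refine tendsto_tsum_of_dominated_convergence (summable_chain_of_le (m := k - 1) (C := C)
    (f := fun s => ((C * ((1 / 2) ^ (k - 1)) ^ s.entry 1 : ℝ) : ℂ)) fun s => ?_).norm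
    (fun s => ?_) (hbound.mono fun c hc s => (hc s).trans ?_)
  · rw [Complex.norm_real, Real.norm_of_nonneg (by positivity)]
  · have t := ((tendsto_qPoch_of_tendsto q (tendsto_div_mul (a * q)) (s.entry (k - 1))).div
      ((tendsto_qPoch_of_tendsto q (tendsto_div_fst (a * q)) (s.entry (k - 1))).mul
        (tendsto_qPoch_of_tendsto q (tendsto_div_snd (a * q)) (s.entry (k - 1))))
      (by simp [qPoch_zero_right])).const_mul (lhsCore q a b k r s)
    simp only [qPoch_zero_right, mul_one, div_one] at t
    exact t
  · rw [Complex.norm_real]; exact le_abs_self _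

theorem expBdd_rhsCore {q a : ℂ} {b : ℕ → ℂ} {r k : ℕ} (hq : ‖q‖ < 1) :
    ExpBdd (rhsCore q a b k r) := by
  set I := Icc 1 (2 * r - 1)
  set B := ∏ i ∈ I, b i with hB
  have e : ∀ j, rhsCore q a b k r j = ((∏ i ∈ I, qPoch q (b i) j) * qPoch q a j * B⁻¹ ^ j
      * (a ^ k) ^ j * (∏ i ∈ I, (qPoch q (a / b i) j)⁻¹) * (qPoch q q j)⁻¹)
      * (1 + a ^ r * B⁻¹ * q ^ j * (∏ i ∈ I, (1 - b i * q ^ j))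
        * ∏ i ∈ I, (1 - a / b i * q ^ j)⁻¹) := by
    intro j
    simp only [rhsCore, prod_inv_distrib, div_mul_eq_mul_div, ← pow_mul, inv_pow]
    simp only [div_eq_mul_inv, mul_inv]
    ring
  simp only [funext e]
  refine ExpBdd.mul (((((ExpBdd.finset_prod _ fun i _ => expBdd_qPoch hq _).mul
    (expBdd_qPoch hq a)).mul (.pow _)).mul (.pow _)).mul
    (.finset_prod _ fun i _ => expBdd_qPoch_inv hq) |>.mul (expBdd_qPoch_inv hq)) ?_
  refine (ExpBdd.const 1).add ((((ExpBdd.const _).mul (.pow q)).mul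
    (.finset_prod _ fun i _ => .of_tendsto (tendsto_one_sub hq _))).mul
    (.finset_prod _ fun i _ => .of_tendsto ((tendsto_one_sub hq _).inv₀ one_ne_zero)))

/-- For all `‖x‖ ≤ ε` the factors are at most `ε + ‖q‖^i`, eventually below `2ε`, so one constant
serves every such `x`. -/
theorem norm_br_le_of_norm_le {q : ℂ} (hq : ‖q‖ < 1) {ε : ℝ} (hε : 0 < ε) :
    ∃ C : ℝ, 0 ≤ C ∧ ∀ x : ℂ, ‖x‖ ≤ ε → ∀ n, ‖br q 1 x n‖ ≤ C * (2 * ε) ^ n := by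
  have ht : Tendsto (fun i : ℕ => ε + ‖q‖ ^ i) atTop (𝓝 (ε + 0)) :=
    (tendsto_pow_atTop_nhds_zero_of_lt_one (norm_nonneg q) hq).const_add ε
  obtain ⟨C, hC, h⟩ := prod_le_const_mul_pow (g := fun i : ℕ => ε + ‖q‖ ^ i)
    (fun i => by positivity) (ρ := 2 * ε) (by positivity) (ht.eventually_le_const (by linarith))
  refine ⟨C, hC, fun x hx n => (h n).trans' ?_⟩
  rw [br, norm_prod]
  refine prod_le_prod (fun _ _ => norm_nonneg _) fun i _ => (norm_sub_le _ _).trans ?_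
  rw [one_mul, norm_pow]
  gcongr

theorem rhs_limit {q : ℂ} (a : ℂ) (b : ℕ → ℂ) (r k : ℕ) (hq : ‖q‖ < 1) :
    (∀ᶠ c in atInfinity, Summable (rhsTerm q a c.1 c.2 b k r)) ∧
    Tendsto (fun c : ℂ × ℂ => rhs q a c.1 c.2 b k r) atInfinity
      (𝓝 (qPochInf q (a / b 1) / qPochInf q a * ∑' j, rhsTermLim q a b k r j)) := by
  obtain ⟨C, M, hC, hM, hcore⟩ := expBdd_rhsCore (a := a) (b := b) (r := r) (k := k) hq
  have hM0 : 0 < M := by linarith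
  -- With this choice the combined ratio `M * (2ε)^2 * 2 * 2` is `1 / (4M)`, hence at most `1/2`. No
  -- decay from the power of `q` is needed, so `r = k` is included.
  set ε : ℝ := 1 / (8 * M) with hε
  have hε0 : 0 < ε := by positivity
  obtain ⟨D, hD, hbr⟩ := norm_br_le_of_norm_le hq hε0
  have hsum : Summable fun j : ℕ => C * D ^ 2 * (1 / 2 : ℝ) ^ j :=
    summable_geometric_two.mul_left _
  have hterm : ∀ c : ℂ × ℂ, c.1 ≠ 0 → c.2 ≠ 0 → ∀ j, rhsTerm q a c.1 c.2 b k r j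
      = rhsCore q a b k r j * q ^ ((k - r) * j ^ 2 + j) * (br q 1 c.1⁻¹ j * br q 1 c.2⁻¹ j
        * (qPoch q (a * q / c.1) j)⁻¹ * (qPoch q (a * q / c.2) j)⁻¹) := by
    intro c h1 h2 j
    rw [rhsTerm, br_inv h1, br_inv h2, mul_pow, div_eq_mul_inv, mul_inv, mul_inv]
    ring
  have hne : ∀ᶠ c : ℂ × ℂ in atInfinity, c.1 ≠ 0 ∧ c.2 ≠ 0 :=
    (tendsto_fst.eventually (Bornology.eventually_ne_cobounded 0)).and
      (tendsto_snd.eventually (Bornology.eventually_ne_cobounded 0))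
  have hbound : ∀ᶠ c in atInfinity, ∀ j,
      ‖rhsTerm q a c.1 c.2 b k r j‖ ≤ C * D ^ 2 * (1 / 2 : ℝ) ^ j := by
    filter_upwards [hne, eventually_norm_le (tendsto_div_fst (a * q)) (half_pos one_pos),
      eventually_norm_le (tendsto_div_snd (a * q)) (half_pos one_pos),
      eventually_norm_le tendsto_inv_fst hε0, eventually_norm_le tendsto_inv_snd hε0]
      with c h0 h1 h2 h3 h4 j
    rw [hterm c h0.1 h0.2, norm_mul, norm_mul, norm_mul, norm_mul, norm_mul]
    calc _ ≤ (C * M ^ j * 1) * ((D * (2 * ε) ^ j) * (D * (2 * ε) ^ j) * 2 ^ j * 2 ^ j) := by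
          gcongr
          · exact hcore j
          · exact norm_qpow_le hq _
          · exact hbr _ h3 j
          · exact hbr _ h4 j
          · exact norm_qPoch_inv_le hq h1 j
          · exact norm_qPoch_inv_le hq h2 j
      _ = C * D ^ 2 * (M * (2 * ε) * (2 * ε) * 2 * 2) ^ j := by
          simp only [mul_pow]; ring
      _ ≤ C * D ^ 2 * (1 / 2) ^ j := by
          gcongr
          rw [hε]
          field_simp
          linarith
  refine ⟨hbound.mono fun c hc => .of_norm_bounded hsum hc, ?_⟩
  refine Tendsto.const_mul _ (tendsto_tsum_of_dominated_convergence hsum (fun j => ?_) hbound)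
  have t := (((tendsto_br_of_tendsto q 1 tendsto_inv_fst j).mul
    (tendsto_br_of_tendsto q 1 tendsto_inv_snd j)).mul
    ((tendsto_qPoch_of_tendsto q (tendsto_div_fst (a * q)) j).inv₀
      (by simp [qPoch_zero_right]))).mul
    ((tendsto_qPoch_of_tendsto q (tendsto_div_snd (a * q)) j).inv₀ (by simp [qPoch_zero_right]))
    |>.const_mul (rhsCore q a b k r j * q ^ ((k - r) * j ^ 2 + j))
  simp only [qPoch_zero_right, inv_one, mul_one, br_one_zero_mul_self] at t
  rw [rhsTermLim, pow_add, ← mul_assoc]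
  exact t.congr' (hne.mono fun c h => (hterm c h.1 h.2 j).symm)

end BressoudIdentity

end

theorem theorem4p1 (q a : ℂ) (hq : ‖q‖ < 1) (ha : ∀ n : ℕ, a * q ^ n ≠ 1)
    (r : ℕ) (hr : 0 < r) (b : ℕ → ℂ)
    (hb : ∀ i ∈ Finset.Icc 1 (2 * r - 1), b i ≠ 0 ∧ ∀ n : ℕ, a * q ^ n ≠ b i) :
    -- the identity for `r < k`, both series being absolutely convergent
    (∀ k : ℕ, r < k → ∀ c₁ c₂ : ℂ, c₁ ≠ 0 → c₂ ≠ 0 →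
      (∀ n : ℕ, a * q ^ (n + 1) ≠ c₁) → (∀ n : ℕ, a * q ^ (n + 1) ≠ c₂) →
        Summable (BressoudIdentity.lhsTerm q a c₁ c₂ b k r) ∧
        Summable (BressoudIdentity.rhsTerm q a c₁ c₂ b k r) ∧
        BressoudIdentity.lhs q a c₁ c₂ b k r = BressoudIdentity.rhs q a c₁ c₂ b k r) ∧
    -- the identity for `r ≤ k` (in particular `r = k`) in the limit `c₁, c₂ → ∞`
    (∀ k : ℕ, r ≤ k →
      (∀ᶠ c : ℂ × ℂ in Bornology.cobounded ℂ ×ˢ Bornology.cobounded ℂ,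
        Summable (BressoudIdentity.lhsTerm q a c.1 c.2 b k r) ∧
        Summable (BressoudIdentity.rhsTerm q a c.1 c.2 b k r)) ∧
      Summable (BressoudIdentity.lhsCore q a b k r) ∧
      Summable (BressoudIdentity.rhsTermLim q a b k r) ∧
      (∑' s : BressoudIdentity.Chain (k - 1), BressoudIdentity.lhsCore q a b k r s) =
        BressoudIdentity.qPochInf q (a / b 1) / BressoudIdentity.qPochInf q a *
          ∑' j : ℕ, BressoudIdentity.rhsTermLim q a b k r j ∧
      Filter.Tendsto
        (fun c : ℂ × ℂ => BressoudIdentity.lhs q a c.1 c.2 b k r)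
        (Bornology.cobounded ℂ ×ˢ Bornology.cobounded ℂ)
        (nhds (∑' s : BressoudIdentity.Chain (k - 1), BressoudIdentity.lhsCore q a b k r s)) ∧
      Filter.Tendsto
        (fun c : ℂ × ℂ => BressoudIdentity.rhs q a c.1 c.2 b k r)
        (Bornology.cobounded ℂ ×ˢ Bornology.cobounded ℂ)
        (nhds (BressoudIdentity.qPochInf q (a / b 1) / BressoudIdentity.qPochInf q a *
          ∑' j : ℕ, BressoudIdentity.rhsTermLim q a b k r j))) := by
  have hb0 : ∀ i ∈ Finset.Icc 1 (2 * r - 1), b i ≠ 0 := fun i hi => (hb i hi).1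
  refine ⟨fun k hk c₁ c₂ h₁ h₂ hc₁ hc₂ =>
    BressoudIdentity.identity_finite hq ha hr hk hb h₁ h₂ hc₁ hc₂, fun k hk => ?_⟩
  obtain ⟨hL, hR, heq⟩ := BressoudIdentity.identity_limit hq ha hr hk hb
  obtain ⟨hl, tl⟩ := BressoudIdentity.lhs_limit (a := a) hq hr hk hb0
  obtain ⟨hr', tr⟩ := BressoudIdentity.rhs_limit a b r k hq
  exact ⟨hl.and hr', hL, hR, heq, tl, tr⟩
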